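/- Let $\lambda,\mu\in\mathbb R$ with $\mu>0$ and $\lambda+2\mu>0$, and let $\mathcal L_0u=\mu\Delta u+(\lambda+\mu)\nabla(\nabla\cdot u)$ be the Lamé operator on vector fields $u=(u_1,u_2)^T$ in $\mathbb R^2$. Put $\Gamma=\{x\in\mathbb R^2:x_1=0\}$ and $R(x_1,x_2)=(-x_1,x_2)$. Let $\Omega\subset\mathbb R^2$ be a domain (a non-empty connected open set) with $Rx\in\Omega$ whenever $x\in\Omega$, and let $\gamma$ be a connected component of $\Omega\cap\Gamma$. Let $u:\Omega\to\mathbb C^2$ be a solution of $$\mathcal L_0u=0\ \text{ in }\Omega,\qquad u=0\ \text{ on }\gamma, \tag{1}$$ in the weak sense: $u$ is continuous in $\Omega$ and vanishes on $\gamma$, and $\int_\Omega u\cdot\mathcal L_0\varphi\,dx=0$ for every $\varphi\in C_c^\infty(\Omega;\mathbb C^2)$, where $a\cdot b=a_1b_1+a_2b_2$. Then $u$ is real-analytic in $\Omega$. Put $c=\frac{\lambda+\mu}{\lambda+3\mu}$ and $$\widetilde{\mathcal D}_0u(x)=\begin{pmatrix}u_1\\-u_2\end{pmatrix}(x)+c\,x_1^2\,\Delta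 u(x)+2c\,x_1\begin{pmatrix}\partial_2u_2\\-\partial_2u_1\end{pmatrix}(x),\qquad x\in\Omega.$$ Then $\widetilde{\mathcal D}_0u$ is again a solution of (1), in the weak sense and also pointwise ($\mathcal L_0\widetilde{\mathcal D}_0u(x)=0$ for all $x\in\Omega$), and $$\widetilde{\mathcal D}_0u(x)=R\,u(Rx)\qquad\text{for all }x\in\Omega.$$ -/

import Mathlib

open MeasureTheory
open scoped ContDiff

noncomputable section

namespace Lame

/-- The plane `ℝ²` with its Euclidean structure. Coordinates `x 0`, `x 1` are `x₁`, `x₂`. -/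
abbrev Plane : Type := EuclideanSpace ℝ (Fin 2)

/-- Complex vector fields `u = (u₁, u₂)ᵀ` on the plane (real vector fields are included
through `ℝ ⊆ ℂ`). -/
abbrev Field2 : Type := Plane → Fin 2 → ℂ

/-- The line `Γ = {x₁ = 0}`. -/
def axisLine : Set Plane := {x | x 0 = 0}

/-- The reflection `R x = (-x₁, x₂)` of points. -/
def refl (x : Plane) : Plane := !₂[-x 0, x 1]

/-- The same reflection `R v = (-v₁, v₂)` acting on values of vector fields. -/
def reflVal (v : Fin 2 → ℂ) : Fin 2 → ℂ := ![-v 0, v 1]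

/-- The partial derivative `∂ⱼ f` of a scalar function. -/
def pd (j : Fin 2) (f : Plane → ℂ) (x : Plane) : ℂ :=
  fderiv ℝ f x (EuclideanSpace.single j 1)

/-- The divergence `∂₁ u₁ + ∂₂ u₂`. -/
def divergence (u : Field2) (x : Plane) : ℂ :=
  pd 0 (fun y => u y 0) x + pd 1 (fun y => u y 1) x

/-- The componentwise Laplacian `Δ u = (Δ u₁, Δ u₂)ᵀ`. -/
def lap (u : Field2) (x : Plane) (i : Fin 2) : ℂ :=
  Laplacian.laplacian (fun y => u y i) x

/-- The Lamé operator `L₀ u = μ Δ u + (λ + μ) ∇ (∇ · u)`. -/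
def lameOp (lam mu : ℝ) (u : Field2) (x : Plane) (i : Fin 2) : ℂ :=
  (mu : ℂ) * lap u x i + ((lam + mu : ℝ) : ℂ) * pd i (divergence u) x

/-- `u` is a (weak) solution of `L₀ u = 0` in `Ω`, `u = 0` on `γ`. The equation is understood in
the sense of distributions (`L₀` is formally self-adjoint), and `u` denotes the continuous
representative, so that `u = 0` on `γ` has a pointwise meaning. -/
structure IsLameSolution (lam mu : ℝ) (Ω γ : Set Plane) (u : Field2) : Prop where
  continuousOn : ContinuousOn u Ω
  weak_eq : ∀ φ : Field2, ContDiff ℝ ∞ φ → HasCompactSupport φ → tsupport φ ⊆ Ω →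
    ∫ x in Ω, ∑ i, u x i * lameOp lam mu φ x i = 0
  eq_zero : ∀ x ∈ γ, u x = 0

/-- The operator
`D̃₀ u = (u₁, -u₂)ᵀ + c x₁² Δ u + 2 c x₁ (∂₂ u₂, -∂₂ u₁)ᵀ`, `c = (λ + μ) / (λ + 3 μ)`. -/
def dTilde (lam mu : ℝ) (u : Field2) (x : Plane) : Fin 2 → ℂ :=
  let c : ℝ := (lam + mu) / (lam + 3 * mu)
  ![u x 0, -u x 1] + ((c * x 0 ^ 2 : ℝ) : ℂ) • lap u x +
    ((2 * c * x 0 : ℝ) : ℂ) • ![pd 1 (fun y => u y 1) x, -pd 1 (fun y => u y 0) x]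

end Lame

end

/-! Write m = μ, k = λ + μ, θ = ∇·u, so the equation is mΔu + k∇θ = 0 with m ≠ 0 and m + k = λ + 2μ
≠ 0. Both `dTilde lam mu u` and the reflected field R u(R·) solve the same system and have the same
Cauchy data on γ, hence they coincide.

Regularity. The Lamé operator applied to a column of its adjugate operator gives μ(λ+2μ)Δ², so each
component of a weak solution is weakly biharmonic (`integral_mul_lapl_lapl_eq_zero`). A Weyl lemma
for Δ² follows from a reproducing formula: the rescaled kernels at two scales differ by the
bilaplacian of a test function, so their integrals against f agree, and letting one scale tend to 0
recovers f as a convolution with a smooth kernel (`integral_mul_scaledKernel_eq`,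
`smoothOn_of_weakly_biharmonic`). Then θ and 2m uᵢ + k xᵢ θ are harmonic, which makes u analytic
(`PointwiseLame.analyticOnNhd`).

Equation. θ is harmonic and u biharmonic. Expanding the system for D̃₀u in powers of x₁, everything
cancels except multiples of (c(k+2m) - k) ∂₁∂₂uⱼ, which vanish exactly for the given c
(`PointwiseLame.reflField`).

Identification. On γ both u and ∂₂u vanish, so D̃₀u and R u(R·) are zero there and both have normal
derivative (∂₁u₁, -∂₁u₂). The line is noncharacteristic, so the difference has all normal
derivatives zero on γ and vanishes near a point of γ by analyticity
(`PointwiseLame.eqOn_zero_of_cauchy_data`). The identity theorem on the connected set Ω finishes the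
proof. -/

noncomputable section

namespace Lame

open Set Filter Topology

/-! ### Partial derivatives on open sets and integration by parts. -/

section Calculus

variable {f g : Plane → ℂ} {x : Plane} {Ω : Set Plane} {i j : Fin 2}

theorem pd_congr (h : f =ᶠ[𝓝 x] g) : pd j f x = pd j g x := by
  simp only [pd, h.fderiv_eq]

theorem pd_eqOn (hΩ : IsOpen Ω) (h : EqOn f g Ω) : EqOn (pd j f) (pd j g) Ω :=
  fun _ hx => pd_congr (h.eventuallyEq_of_mem (hΩ.mem_nhds hx))

theorem differentiableAt_of_smoothOn (hΩ : IsOpen Ω) (hf : ContDiffOn ℝ ∞ f Ω) (hx : x ∈ Ω) :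
    DifferentiableAt ℝ f x :=
  (hf.contDiffAt (hΩ.mem_nhds hx)).differentiableAt (by simp)

theorem pd_add (hΩ : IsOpen Ω) (hf : ContDiffOn ℝ ∞ f Ω) (hg : ContDiffOn ℝ ∞ g Ω) (hx : x ∈ Ω) :
    pd j (fun y => f y + g y) x = pd j f x + pd j g x := by
  simp [pd, fderiv_fun_add (differentiableAt_of_smoothOn hΩ hf hx)
    (differentiableAt_of_smoothOn hΩ hg hx)]

theorem pd_sub (hΩ : IsOpen Ω) (hf : ContDiffOn ℝ ∞ f Ω) (hg : ContDiffOn ℝ ∞ g Ω) (hx : x ∈ Ω) :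
    pd j (fun y => f y - g y) x = pd j f x - pd j g x := by
  simp [pd, fderiv_fun_sub (differentiableAt_of_smoothOn hΩ hf hx)
    (differentiableAt_of_smoothOn hΩ hg hx)]

theorem pd_mul (hΩ : IsOpen Ω) (hf : ContDiffOn ℝ ∞ f Ω) (hg : ContDiffOn ℝ ∞ g Ω) (hx : x ∈ Ω) :
    pd j (fun y => f y * g y) x = f x * pd j g x + g x * pd j f x := by
  simp [pd, fderiv_fun_mul (differentiableAt_of_smoothOn hΩ hf hx)
    (differentiableAt_of_smoothOn hΩ hg hx)]

theorem pd_const_mul (hΩ : IsOpen Ω) (hf : ContDiffOn ℝ ∞ f Ω) (hx : x ∈ Ω) (c : ℂ) :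
    pd j (fun y => c * f y) x = c * pd j f x := by
  simp [pd, fderiv_const_mul (differentiableAt_of_smoothOn hΩ hf hx)]

theorem pd_zero : pd j (fun _ => (0 : ℂ)) x = 0 := by
  simp [pd]

/-- The coordinate functions, with complex values. -/
def coord (i : Fin 2) (x : Plane) : ℂ := ((x i : ℝ) : ℂ)

theorem contDiff_coord : ContDiff ℝ ∞ (coord i) :=
  Complex.ofRealCLM.contDiff.comp (contDiff_piLp_apply 2)

theorem pd_coord : pd j (coord i) x = if i = j then 1 else 0 := by
  have h : HasFDerivAt (coord i)
      (Complex.ofRealCLM.comp (EuclideanSpace.proj (𝕜 := ℝ) i : Plane →L[ℝ] ℝ)) x :=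
    (Complex.ofRealCLM.comp (EuclideanSpace.proj (𝕜 := ℝ) i : Plane →L[ℝ] ℝ)).hasFDerivAt
  rw [pd, h.fderiv]
  simp
  split_ifs <;> simp

theorem smoothOn_pd (hΩ : IsOpen Ω) (hf : ContDiffOn ℝ ∞ f Ω) : ContDiffOn ℝ ∞ (pd j f) Ω :=
  (hf.fderiv_of_isOpen hΩ (by simp)).clm_apply contDiffOn_const

theorem contDiff_pd (hf : ContDiff ℝ ∞ f) : ContDiff ℝ ∞ (pd j f) :=
  contDiffOn_univ.1 (smoothOn_pd isOpen_univ hf.contDiffOn)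

theorem pd_pd_apply (hf : ContDiffAt ℝ 2 f x) :
    pd i (pd j f) x =
      fderiv ℝ (fderiv ℝ f) x (EuclideanSpace.single i 1) (EuclideanSpace.single j 1) := by
  have h : DifferentiableAt ℝ (fderiv ℝ f) x :=
    (hf.fderiv_right (m := 1) (by norm_num)).differentiableAt (by simp)
  have : HasFDerivAt (pd j f) _ x := h.hasFDerivAt.clm_apply (hasFDerivAt_const _ x)
  rw [pd, this.fderiv]
  simp

theorem pd_comm (hΩ : IsOpen Ω) (hf : ContDiffOn ℝ ∞ f Ω) (hx : x ∈ Ω) :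
    pd i (pd j f) x = pd j (pd i f) x := by
  have h : ContDiffAt ℝ 2 f x :=
    (hf.contDiffAt (hΩ.mem_nhds hx)).of_le (ENat.LEInfty.out)
  rw [pd_pd_apply h, pd_pd_apply h]
  exact h.isSymmSndFDerivAt (by simp) _ _

/-- The Laplacian of a scalar function written with iterated partial derivatives. -/
def lapl (f : Plane → ℂ) (x : Plane) : ℂ := pd 0 (pd 0 f) x + pd 1 (pd 1 f) x

theorem laplacian_eq_lapl (hf : ContDiffAt ℝ 2 f x) : Laplacian.laplacian f x = lapl f x := by
  rw [lapl, pd_pd_apply hf, pd_pd_apply hf,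
    InnerProductSpace.laplacian_eq_iteratedFDeriv_orthonormalBasis f
      (EuclideanSpace.basisFun (Fin 2) ℝ)]
  simp [iteratedFDeriv_two_apply]

theorem laplacian_eq_lapl_of_smoothOn (hΩ : IsOpen Ω) (hf : ContDiffOn ℝ ∞ f Ω) (hx : x ∈ Ω) :
    Laplacian.laplacian f x = lapl f x :=
  laplacian_eq_lapl ((hf.contDiffAt (hΩ.mem_nhds hx)).of_le (ENat.LEInfty.out))

theorem smoothOn_lapl (hΩ : IsOpen Ω) (hf : ContDiffOn ℝ ∞ f Ω) : ContDiffOn ℝ ∞ (lapl f) Ω :=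
  (smoothOn_pd hΩ (smoothOn_pd hΩ hf)).add (smoothOn_pd hΩ (smoothOn_pd hΩ hf))

theorem lapl_eqOn (hΩ : IsOpen Ω) (h : EqOn f g Ω) : EqOn (lapl f) (lapl g) Ω := fun _ hx => by
  rw [lapl, lapl, pd_eqOn hΩ (pd_eqOn hΩ h) hx, pd_eqOn hΩ (pd_eqOn hΩ h) hx]

theorem lapl_add (hΩ : IsOpen Ω) (hf : ContDiffOn ℝ ∞ f Ω) (hg : ContDiffOn ℝ ∞ g Ω)
    (hx : x ∈ Ω) : lapl (fun y => f y + g y) x = lapl f x + lapl g x := by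
  have h (j) : EqOn (pd j fun y => f y + g y) (fun y => pd j f y + pd j g y) Ω :=
    fun _ hy => pd_add hΩ hf hg hy
  simp only [lapl, pd_eqOn hΩ (h _) hx, pd_add hΩ (smoothOn_pd hΩ hf) (smoothOn_pd hΩ hg) hx]
  ring

theorem lapl_const_mul (hΩ : IsOpen Ω) (hf : ContDiffOn ℝ ∞ f Ω) (hx : x ∈ Ω) (c : ℂ) :
    lapl (fun y => c * f y) x = c * lapl f x := by
  have h (j) : EqOn (pd j fun y => c * f y) (fun y => c * pd j f y) Ω :=
    fun _ hy => pd_const_mul hΩ hf hy c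
  simp only [lapl, pd_eqOn hΩ (h _) hx, pd_const_mul hΩ (smoothOn_pd hΩ hf) hx]
  ring

theorem pd_lapl (hΩ : IsOpen Ω) (hf : ContDiffOn ℝ ∞ f Ω) (hx : x ∈ Ω) :
    pd j (lapl f) x = lapl (pd j f) x := by
  have h1 (i) : pd j (pd i (pd i f)) x = pd i (pd i (pd j f)) x := by
    rw [pd_comm hΩ (smoothOn_pd hΩ hf) hx,
      pd_eqOn hΩ (fun y hy => pd_comm hΩ hf hy : EqOn (pd j (pd i f)) (pd i (pd j f)) Ω) hx]
  have hs (i) := smoothOn_pd (j := i) hΩ (smoothOn_pd (j := i) hΩ hf)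
  rw [lapl, ← h1, ← h1, ← pd_add hΩ (hs 0) (hs 1) hx]
  rfl

/-- The Laplacian of a coordinate times a function. -/
theorem lapl_coord_mul (hΩ : IsOpen Ω) (hf : ContDiffOn ℝ ∞ f Ω) (hx : x ∈ Ω) :
    lapl (fun y => coord i y * f y) x = coord i x * lapl f x + 2 * pd i f x := by
  have hc : ContDiffOn ℝ ∞ (coord i) Ω := contDiff_coord.contDiffOn
  have h (j) : EqOn (pd j fun y => coord i y * f y)
      (fun y => coord i y * pd j f y + (if i = j then 1 else 0) * f y) Ω := fun y hy => by
    rw [pd_mul hΩ hc hf hy, pd_coord, mul_comm (f y)]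
  have hs (j) := smoothOn_pd (j := j) hΩ hf
  simp only [lapl, pd_eqOn hΩ (h _) hx,
    pd_add hΩ (hc.mul (hs _)) (contDiffOn_const.mul hf) hx, pd_mul hΩ hc (hs _) hx,
    pd_const_mul hΩ hf hx, pd_coord]
  fin_cases i <;> simp <;> ring

theorem tsupport_pd_subset : tsupport (pd j g) ⊆ tsupport g := by
  refine (closure_mono ?_).trans (tsupport_fderiv_subset ℝ (f := g))
  intro x hx h
  exact hx (by simp [pd, h])

/-- Nothing is known about `f` outside Ω, but `g` vanishes near every point there, so the product is
continuous on the whole plane. Integrals over Ω can thus be treated as integrals over the plane. -/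
theorem integrable_mul_of_tsupport_subset (hΩ : IsOpen Ω) (hf : ContinuousOn f Ω)
    (hg : Continuous g) (hgc : HasCompactSupport g) (hgΩ : tsupport g ⊆ Ω) :
    Integrable (fun x => f x * g x) := by
  refine Continuous.integrable_of_hasCompactSupport ?_
    (HasCompactSupport.mul_left (f := f) (f' := g) hgc)
  rw [continuous_iff_continuousAt]
  intro x
  by_cases hx : x ∈ Ω
  · exact (hf.continuousAt (hΩ.mem_nhds hx)).mul hg.continuousAt
  · have h0 : (fun x => f x * g x) =ᶠ[𝓝 x] fun _ => 0 := by
      filter_upwards [(isClosed_tsupport g).isOpen_compl.mem_nhds fun h => hx (hgΩ h)] with y hy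
      simp [image_eq_zero_of_notMem_tsupport hy]
    exact continuousAt_const.congr h0.symm

theorem hasCompactSupport_pd (hgc : HasCompactSupport g) : HasCompactSupport (pd j g) :=
  hgc.of_isClosed_subset (isClosed_tsupport _) tsupport_pd_subset

/-- Integration by parts against a compactly supported function. -/
theorem integral_mul_pd (hΩ : IsOpen Ω) (hf : ContDiffOn ℝ ∞ f Ω) (hg : ContDiff ℝ ∞ g)
    (hgc : HasCompactSupport g) (hgΩ : tsupport g ⊆ Ω) :
    ∫ x, f x * pd j g x = -∫ x, pd j f x * g x := by
  exact integral_bilinear_hasFDerivAt_right_eq_neg_left_of_integrable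
    (B := ContinuousLinearMap.mul ℝ ℂ) (f' := fderiv ℝ f) (g' := fderiv ℝ g)
    (integrable_mul_of_tsupport_subset hΩ (smoothOn_pd hΩ hf).continuousOn hg.continuous hgc hgΩ)
    (integrable_mul_of_tsupport_subset hΩ hf.continuousOn (contDiff_pd hg).continuous
      (hasCompactSupport_pd hgc) (tsupport_pd_subset.trans hgΩ))
    (integrable_mul_of_tsupport_subset hΩ hf.continuousOn hg.continuous hgc hgΩ)
    (fun x hx => (differentiableAt_of_smoothOn hΩ hf (hgΩ hx)).hasFDerivAt)
    (fun x _ => (hg.differentiable (by simp) x).hasFDerivAt)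

theorem integral_mul_pd_pd (hΩ : IsOpen Ω) (hf : ContDiffOn ℝ ∞ f Ω) (hg : ContDiff ℝ ∞ g)
    (hgc : HasCompactSupport g) (hgΩ : tsupport g ⊆ Ω) :
    ∫ x, f x * pd i (pd j g) x = ∫ x, pd j (pd i f) x * g x := by
  rw [integral_mul_pd hΩ hf (contDiff_pd hg) (hasCompactSupport_pd hgc)
    (tsupport_pd_subset.trans hgΩ), integral_mul_pd hΩ (smoothOn_pd hΩ hf) hg hgc hgΩ, neg_neg]

end Calculus

/-! ### Algebra of the pointwise Lamé system and its invariance under D̃₀. -/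

section Identities

variable {u : Field2} {x : Plane} {Ω : Set Plane} {m k : ℂ}

/-- Smoothness of a vector field on a set, by components. -/
def SmoothField (u : Field2) (Ω : Set Plane) : Prop :=
  ∀ i, ContDiffOn ℝ ∞ (fun y => u y i) Ω

/-- The equation `m Δ u + k ∇ (∇ · u) = 0`, pointwise in `Ω`. -/
def PointwiseLame (m k : ℂ) (u : Field2) (Ω : Set Plane) : Prop :=
  ∀ i, ∀ x ∈ Ω, m * lapl (fun y => u y i) x + k * pd i (divergence u) x = 0

theorem smoothOn_divergence (hΩ : IsOpen Ω) (hu : SmoothField u Ω) :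
    ContDiffOn ℝ ∞ (divergence u) Ω :=
  (smoothOn_pd hΩ (hu 0)).add (smoothOn_pd hΩ (hu 1))

theorem divergence_eqOn {v : Field2} (hΩ : IsOpen Ω) (h : EqOn u v Ω) :
    EqOn (divergence u) (divergence v) Ω := fun x hx => by
  have hi (i) : EqOn (fun y => u y i) (fun y => v y i) Ω := fun y hy => congrFun (h hy) i
  rw [divergence, divergence, pd_eqOn hΩ (hi 0) hx, pd_eqOn hΩ (hi 1) hx]

theorem lameOp_eq {lam mu : ℝ} (hΩ : IsOpen Ω) (hu : SmoothField u Ω) (hx : x ∈ Ω) (i : Fin 2) :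
    lameOp lam mu u x i =
      (mu : ℂ) * lapl (fun y => u y i) x + ((lam + mu : ℝ) : ℂ) * pd i (divergence u) x := by
  rw [lameOp, lap, laplacian_eq_lapl_of_smoothOn hΩ (hu i) hx]

theorem PointwiseLame.congr {v : Field2} (hΩ : IsOpen Ω) (hE : PointwiseLame m k u Ω)
    (h : EqOn u v Ω) : PointwiseLame m k v Ω := fun i x hx => by
  have hi : EqOn (fun y => u y i) (fun y => v y i) Ω := fun y hy => congrFun (h hy) i
  rw [← lapl_eqOn hΩ hi hx, ← pd_eqOn hΩ (divergence_eqOn hΩ h) hx, hE i x hx]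

theorem PointwiseLame.pd_eq (hΩ : IsOpen Ω) (hu : SmoothField u Ω) (hE : PointwiseLame m k u Ω)
    (i j : Fin 2) (hx : x ∈ Ω) :
    m * pd j (lapl fun y => u y i) x + k * pd j (pd i (divergence u)) x = 0 := by
  have hl := smoothOn_lapl hΩ (hu i)
  have hd := smoothOn_pd (j := i) hΩ (smoothOn_divergence hΩ hu)
  have h := pd_eqOn (j := j) hΩ (fun y hy => hE i y hy :
    EqOn (fun y => m * lapl (fun z => u z i) y + k * pd i (divergence u) y) (fun _ => 0) Ω) hx
  rwa [pd_add hΩ (contDiffOn_const.mul hl) (contDiffOn_const.mul hd) hx, pd_const_mul hΩ hl hx,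
    pd_const_mul hΩ hd hx, pd_zero] at h

theorem lapl_divergence (hΩ : IsOpen Ω) (hu : SmoothField u Ω) (hx : x ∈ Ω) :
    lapl (divergence u) x =
      pd 0 (lapl fun y => u y 0) x + pd 1 (lapl fun y => u y 1) x := by
  rw [pd_lapl hΩ (hu 0) hx, pd_lapl hΩ (hu 1) hx,
    ← lapl_add hΩ (smoothOn_pd hΩ (hu 0)) (smoothOn_pd hΩ (hu 1)) hx]
  rfl

/-- The divergence of a solution is harmonic. -/
theorem PointwiseLame.lapl_divergence_eq_zero (hΩ : IsOpen Ω) (hu : SmoothField u Ω)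
    (hE : PointwiseLame m k u Ω) (hmk : m + k ≠ 0) (hx : x ∈ Ω) :
    lapl (divergence u) x = 0 := by
  have h0 := hE.pd_eq hΩ hu 0 0 hx
  have h1 := hE.pd_eq hΩ hu 1 1 hx
  have h2 := lapl_divergence hΩ hu hx
  have h3 : lapl (divergence u) x =
    pd 0 (pd 0 (divergence u)) x + pd 1 (pd 1 (divergence u)) x := rfl
  -- The divergence of the equation is (m + k) Δθ = 0.
  apply mul_left_cancel₀ hmk
  linear_combination h0 + h1 + m * h2 + k * h3

/-- The components of a solution are biharmonic. -/
theorem PointwiseLame.lapl_lapl_eq_zero (hΩ : IsOpen Ω) (hu : SmoothField u Ω)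
    (hE : PointwiseLame m k u Ω) (hm : m ≠ 0) (hmk : m + k ≠ 0) (i : Fin 2) (hx : x ∈ Ω) :
    lapl (lapl fun y => u y i) x = 0 := by
  have hθ := smoothOn_divergence hΩ hu
  have h (j) : EqOn (fun y => m * pd j (lapl fun z => u z i) y)
      (fun y => (-k) * pd j (pd i (divergence u)) y) Ω := fun y hy => by
    have := hE.pd_eq hΩ hu i j hy
    linear_combination this
  have h2 (j) : m * pd j (pd j (lapl fun z => u z i)) x =
      (-k) * pd j (pd j (pd i (divergence u))) x := by
    rw [← pd_const_mul hΩ (smoothOn_pd hΩ (smoothOn_lapl hΩ (hu i))) hx,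
      ← pd_const_mul hΩ (smoothOn_pd hΩ (smoothOn_pd hΩ hθ)) hx]
    exact pd_eqOn hΩ (h j) hx
  have h3 : lapl (pd i (divergence u)) x = 0 := by
    rw [← pd_lapl hΩ hθ hx, pd_eqOn hΩ
      (fun y hy => hE.lapl_divergence_eq_zero hΩ hu hmk hy :
        EqOn (lapl (divergence u)) (fun _ => 0) Ω) hx, pd_zero]
  -- The Laplacian of the equation is m ΔΔuᵢ = -k ∂ᵢΔθ, and Δθ = 0.
  apply mul_left_cancel₀ hm
  rw [lapl] at h3 ⊢
  linear_combination h2 0 + h2 1 - k * h3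

section Quadratic

variable {A B C : Plane → ℂ}

/-- Both components of D̃₀u are quadratic in x₁ with coefficients built from u. The Horner form lets
the product rule for one coordinate be applied twice. -/
theorem pd_quadratic (hΩ : IsOpen Ω) (hA : ContDiffOn ℝ ∞ A Ω) (hB : ContDiffOn ℝ ∞ B Ω)
    (hC : ContDiffOn ℝ ∞ C Ω) (j : Fin 2) (hx : x ∈ Ω) :
    pd j (fun y => A y + coord 0 y * (B y + coord 0 y * C y)) x =
      pd j A x + coord 0 x * (pd j B x + coord 0 x * pd j C x) +
        (if 0 = j then 1 else 0) * (B x + 2 * coord 0 x * C x) := by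
  have hX : ContDiffOn ℝ ∞ (coord 0) Ω := contDiff_coord.contDiffOn
  rw [pd_add hΩ hA (hX.mul (hB.add (hX.mul hC))) hx, pd_mul hΩ hX (hB.add (hX.mul hC)) hx,
    pd_add hΩ hB (hX.mul hC) hx, pd_mul hΩ hX hC hx, pd_coord]
  ring

theorem lapl_quadratic (hΩ : IsOpen Ω) (hA : ContDiffOn ℝ ∞ A Ω) (hB : ContDiffOn ℝ ∞ B Ω)
    (hC : ContDiffOn ℝ ∞ C Ω) (hx : x ∈ Ω) :
    lapl (fun y => A y + coord 0 y * (B y + coord 0 y * C y)) x =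
      lapl A x + 2 * pd 0 B x + 2 * C x + coord 0 x * (lapl B x + 4 * pd 0 C x) +
        coord 0 x ^ 2 * lapl C x := by
  have hX : ContDiffOn ℝ ∞ (coord 0) Ω := contDiff_coord.contDiffOn
  rw [lapl_add hΩ hA (hX.mul (hB.add (hX.mul hC))) hx, lapl_coord_mul hΩ (hB.add (hX.mul hC)) hx,
    lapl_add hΩ hB (hX.mul hC) hx, lapl_coord_mul hΩ hC hx, pd_add hΩ hB (hX.mul hC) hx,
    pd_mul hΩ hX hC hx, pd_coord]
  simp
  ring

end Quadratic

/-- The first component of `D̃₀ u`, written with `lapl`. -/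
def reflFst (c : ℂ) (u : Field2) (y : Plane) : ℂ :=
  u y 0 + coord 0 y * (2 * c * pd 1 (fun z => u z 1) y + coord 0 y * (c * lapl (fun z => u z 0) y))

/-- The second component of `D̃₀ u`, written with `lapl`. -/
def reflSnd (c : ℂ) (u : Field2) (y : Plane) : ℂ :=
  (-1) * u y 1 +
    coord 0 y * (-2 * c * pd 1 (fun z => u z 0) y + coord 0 y * (c * lapl (fun z => u z 1) y))

/-- `D̃₀ u`, written with `lapl`. -/
def reflField (c : ℂ) (u : Field2) : Field2 := fun y => ![reflFst c u y, reflSnd c u y]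

theorem smoothField_reflField (hΩ : IsOpen Ω) (hu : SmoothField u Ω) (c : ℂ) :
    SmoothField (reflField c u) Ω := by
  have hX : ContDiffOn ℝ ∞ (coord 0) Ω := contDiff_coord.contDiffOn
  have hp (i) := smoothOn_pd (j := 1) hΩ (hu i)
  have hl (i) := smoothOn_lapl hΩ (hu i)
  intro i
  fin_cases i
  · exact (hu 0).add (hX.mul ((contDiffOn_const.mul (hp 1)).add
      (hX.mul (contDiffOn_const.mul (hl 0)))))
  · exact (contDiffOn_const.mul (hu 1)).add (hX.mul ((contDiffOn_const.mul (hp 0)).add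
      (hX.mul (contDiffOn_const.mul (hl 1)))))

/-- The x₁² terms add up to c x₁² Δθ = 0. In the x₁ terms, Δu₁ from differentiating x₁² cancels
against ∂₂∂₂u₁, leaving 2c x₁ ∂₁θ. -/
theorem PointwiseLame.divergence_reflField (hΩ : IsOpen Ω) (hu : SmoothField u Ω)
    (hE : PointwiseLame m k u Ω) (hmk : m + k ≠ 0) (c : ℂ) (hx : x ∈ Ω) :
    divergence (reflField c u) x = pd 0 (fun y => u y 0) x +
      ((2 * c - 1) * pd 1 (fun y => u y 1) x + coord 0 x * (2 * c * pd 0 (divergence u) x)) := by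
  have hp (i) (j : Fin 2) := smoothOn_pd (j := j) hΩ (hu i)
  have hl (i) := smoothOn_lapl hΩ (hu i)
  have h0 : pd 0 (reflFst c u) x = _ := pd_quadratic hΩ (hu 0)
    ((contDiffOn_const (c := 2 * c)).mul (hp 1 1)) ((contDiffOn_const (c := c)).mul (hl 0)) 0 hx
  have h1 : pd 1 (reflSnd c u) x = _ := pd_quadratic hΩ
    ((contDiffOn_const (c := -1)).mul (hu 1)) ((contDiffOn_const (c := -2 * c)).mul (hp 0 1))
    ((contDiffOn_const (c := c)).mul (hl 1)) 1 hx
  have hθ : pd 0 (divergence u) x = _ := pd_add hΩ (hp 0 0) (hp 1 1) hx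
  have h2 := hE.lapl_divergence_eq_zero hΩ hu hmk hx
  rw [lapl_divergence hΩ hu hx] at h2
  have h3 : lapl (fun z => u z 0) x =
    pd 0 (pd 0 fun z => u z 0) x + pd 1 (pd 1 fun z => u z 0) x := rfl
  change pd 0 (reflFst c u) x + pd 1 (reflSnd c u) x = _
  simp only [pd_const_mul hΩ (hp _ _) hx, pd_const_mul hΩ (hl _) hx,
    pd_const_mul hΩ (hu 1) hx] at h0 h1
  simp at h0 h1
  rw [h0, h1, hθ]
  linear_combination coord 0 x ^ 2 * c * h2 + 2 * c * coord 0 x * h3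

/-- `D̃₀` maps solutions of the Lamé system to solutions. -/
theorem PointwiseLame.reflField (hΩ : IsOpen Ω) (hu : SmoothField u Ω)
    (hE : PointwiseLame m k u Ω) (hm : m ≠ 0) (hmk : m + k ≠ 0) {c : ℂ}
    (hc : c * (k + 2 * m) = k) : PointwiseLame m k (reflField c u) Ω := by
  have hp (i) (j : Fin 2) := smoothOn_pd (j := j) hΩ (hu i)
  have hl (i) := smoothOn_lapl hΩ (hu i)
  have hX : ContDiffOn ℝ ∞ (coord 0) Ω := contDiff_coord.contDiffOn
  have hθ := smoothOn_divergence hΩ hu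
  intro i x hx
  have hd (j : Fin 2) : pd j (divergence (Lame.reflField c u)) x = pd j (pd 0 (fun y => u y 0)) x +
      ((2 * c - 1) * pd j (pd 1 fun y => u y 1) x +
        (coord 0 x * (2 * c * pd j (pd 0 (divergence u)) x) +
          2 * c * pd 0 (divergence u) x * if 0 = j then 1 else 0)) := by
    have hs := (contDiffOn_const (c := 2 * c)).mul (smoothOn_pd (j := 0) hΩ hθ)
    rw [pd_eqOn hΩ (fun y hy => hE.divergence_reflField hΩ hu hmk c hy) hx,
      pd_add hΩ (hp 0 0) ((contDiffOn_const.mul (hp 1 1)).add (hX.mul hs)) hx,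
      pd_add hΩ (contDiffOn_const.mul (hp 1 1)) (hX.mul hs) hx, pd_const_mul hΩ (hp 1 1) hx,
      pd_mul hΩ hX hs hx, pd_const_mul hΩ (smoothOn_pd hΩ hθ) hx, pd_coord]
  have hθj (j : Fin 2) : pd j (divergence u) x = _ := pd_add hΩ (hp 0 0) (hp 1 1) hx
  have hh : pd 0 (pd 0 (divergence u)) x + pd 1 (pd 1 (divergence u)) x = 0 :=
    hE.lapl_divergence_eq_zero hΩ hu hmk hx
  have e0 := hE 0 x hx
  have e1 := hE 1 x hx
  have e (i j) := hE.pd_eq hΩ hu i j hx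
  rw [hd i]
  fin_cases i
  · have h0 : lapl (reflFst c u) x = _ := lapl_quadratic hΩ (hu 0)
      ((contDiffOn_const (c := 2 * c)).mul (hp 1 1)) ((contDiffOn_const (c := c)).mul (hl 0)) hx
    simp only [pd_const_mul hΩ (hp _ _) hx, pd_const_mul hΩ (hl _) hx,
      lapl_const_mul hΩ (hp _ _) hx, lapl_const_mul hΩ (hl _) hx,
      hE.lapl_lapl_eq_zero hΩ hu hm hmk _ hx, ← pd_lapl hΩ (hu _) hx] at h0
    change m * lapl (reflFst c u) x + _ = 0
    rw [h0]
    simp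
    -- Free of x₁, what remains beyond multiples of the equation is 2(c(k + 2m) - k) ∂₁∂₂u₂; this
    -- determines c. The x₁ terms are handled by the differentiated equations and Δθ = 0, the x₁²
    -- terms by biharmonicity.
    linear_combination (1 + 2 * c) * e0 + 4 * c * coord 0 x * e 0 0 + 2 * c * coord 0 x * e 1 1
      - 2 * c * k * coord 0 x * hh + 2 * pd 0 (pd 1 fun y => u y 1) x * hc - k * hθj 0
  · have h0 : lapl (reflSnd c u) x = _ := lapl_quadratic hΩ
      ((contDiffOn_const (c := -1)).mul (hu 1)) ((contDiffOn_const (c := -2 * c)).mul (hp 0 1))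
      ((contDiffOn_const (c := c)).mul (hl 1)) hx
    simp only [pd_const_mul hΩ (hp _ _) hx, pd_const_mul hΩ (hl _) hx,
      lapl_const_mul hΩ (hp _ _) hx, lapl_const_mul hΩ (hl _) hx, lapl_const_mul hΩ (hu _) hx,
      hE.lapl_lapl_eq_zero hΩ hu hm hmk _ hx, ← pd_lapl hΩ (hu _) hx] at h0
    change m * lapl (reflSnd c u) x + _ = 0
    rw [h0]
    have hc1 := pd_comm (i := 0) (j := 1) hΩ (hu 0) hx
    have hc2 := pd_comm (i := 0) (j := 1) hΩ hθ hx
    simp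
    linear_combination (2 * c - 1) * e1 - 2 * c * coord 0 x * e 0 1 + 4 * c * coord 0 x * e 1 0
      - 4 * c * k * coord 0 x * hc2 - 2 * pd 1 (pd 0 fun y => u y 0) x * hc
      - (2 * c - 1) * k * hθj 1 - 4 * c * m * hc1

end Identities

/-! ### Analyticity of harmonic functions and of smooth Lamé solutions. -/

section Analyticity

open InnerProductSpace

/-- Precomposition with a linear isometry preserves the Laplacian. -/
theorem laplacian_comp_linearIsometryEquiv {E E' F : Type*} [NormedAddCommGroup E]
    [InnerProductSpace ℝ E] [FiniteDimensional ℝ E] [NormedAddCommGroup E']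
    [InnerProductSpace ℝ E'] [FiniteDimensional ℝ E'] [NormedAddCommGroup F] [NormedSpace ℝ F]
    (e : E ≃ₗᵢ[ℝ] E') (f : E' → F) (z : E) :
    Laplacian.laplacian (f ∘ e) z = Laplacian.laplacian f (e z) := by
  rw [laplacian_eq_iteratedFDeriv_orthonormalBasis _ (stdOrthonormalBasis ℝ E),
    laplacian_eq_iteratedFDeriv_orthonormalBasis _ ((stdOrthonormalBasis ℝ E).map e)]
  refine Finset.sum_congr rfl fun i _ => ?_
  have h := e.toContinuousLinearEquiv.iteratedFDerivWithin_comp_right f uniqueDiffOn_univ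
    (mem_univ (e z)) 2
  simp only [preimage_univ, iteratedFDerivWithin_univ] at h
  change iteratedFDeriv ℝ 2 (f ∘ e) z = _ at h
  rw [h]
  simp only [ContinuousMultilinearMap.compContinuousLinearMap_apply]
  congr 1
  ext j
  fin_cases j <;> simp

theorem HarmonicAt.comp_linearIsometryEquiv {E E' F : Type*} [NormedAddCommGroup E]
    [InnerProductSpace ℝ E] [FiniteDimensional ℝ E] [NormedAddCommGroup E']
    [InnerProductSpace ℝ E'] [FiniteDimensional ℝ E'] [NormedAddCommGroup F] [NormedSpace ℝ F]
    (e : E ≃ₗᵢ[ℝ] E') {f : E' → F} {z : E} (h : HarmonicAt f (e z)) : HarmonicAt (f ∘ e) z := by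
  refine ⟨h.1.comp z e.contDiff.contDiffAt, ?_⟩
  filter_upwards [e.continuous.continuousAt.eventually h.2] with y hy
  rw [laplacian_comp_linearIsometryEquiv, hy]
  rfl

/-- Complex-valued harmonic functions on the plane are real-analytic. -/
theorem HarmonicAt.analyticAt_plane {f : Plane → ℂ} {x : Plane} (h : HarmonicAt f x) :
    AnalyticAt ℝ f x := by
  let e : ℂ ≃ₗᵢ[ℝ] Plane := Complex.orthonormalBasisOneI.repr
  have hx : e (e.symm x) = x := e.apply_symm_apply x
  -- Real-valued harmonic functions on ℂ are analytic; this is carried to the plane by an isometry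
  -- and used for the real and imaginary parts.
  have key (l : ℂ →L[ℝ] ℝ) : AnalyticAt ℝ (fun y => l (f y)) x := by
    have h1 : HarmonicAt (l ∘ f) (e (e.symm x)) := hx.symm ▸ h.comp_CLM l
    have h2 := _root_.HarmonicAt.analyticAt (HarmonicAt.comp_linearIsometryEquiv e h1)
    have h3 := h2.comp (e.symm.toContinuousLinearEquiv.analyticAt x)
    refine h3.congr (Eventually.of_forall fun y => ?_)
    simp
  have h4 : AnalyticAt ℝ (fun y => ((Complex.reCLM (f y) : ℝ) : ℂ) +
      ((Complex.imCLM (f y) : ℝ) : ℂ) * Complex.I) x :=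
    ((Complex.ofRealCLM.analyticAt _).comp (key Complex.reCLM)).add
      (((Complex.ofRealCLM.analyticAt _).comp (key Complex.imCLM)).mul analyticAt_const)
  refine h4.congr (Eventually.of_forall fun y => ?_)
  simp

theorem analyticOnNhd_of_lapl_eq_zero {f : Plane → ℂ} {Ω : Set Plane} (hΩ : IsOpen Ω)
    (hf : ContDiffOn ℝ ∞ f Ω) (h : ∀ x ∈ Ω, lapl f x = 0) : AnalyticOnNhd ℝ f Ω := by
  intro x hx
  refine HarmonicAt.analyticAt_plane
    ⟨(hf.contDiffAt (hΩ.mem_nhds hx)).of_le ENat.LEInfty.out, ?_⟩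
  filter_upwards [hΩ.mem_nhds hx] with y hy
  rw [laplacian_eq_lapl_of_smoothOn hΩ hf hy, h y hy]
  rfl

theorem analyticAt_coord {i : Fin 2} {x : Plane} : AnalyticAt ℝ (coord i) x :=
  (Complex.ofRealCLM.comp
    (EuclideanSpace.proj (𝕜 := ℝ) i : Plane →L[ℝ] ℝ)).analyticAt x

/-- Smooth solutions of the Lamé system are real-analytic. -/
theorem PointwiseLame.analyticOnNhd {u : Field2} {Ω : Set Plane} {m k : ℂ} (hΩ : IsOpen Ω)
    (hu : SmoothField u Ω) (hE : PointwiseLame m k u Ω) (hm : m ≠ 0) (hmk : m + k ≠ 0) :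
    AnalyticOnNhd ℝ u Ω := by
  have hθ := smoothOn_divergence hΩ hu
  have hθa : AnalyticOnNhd ℝ (divergence u) Ω :=
    analyticOnNhd_of_lapl_eq_zero hΩ hθ fun x hx => hE.lapl_divergence_eq_zero hΩ hu hmk hx
  refine analyticOnNhd_pi_iff.2 fun i => ?_
  have hX : ContDiffOn ℝ ∞ (coord i) Ω := contDiff_coord.contDiffOn
  -- Since θ is harmonic, Δ(xᵢθ) = 2∂ᵢθ, so the Laplacian of this combination is twice the i-th
  -- equation.
  have hh : AnalyticOnNhd ℝ
      (fun y => 2 * m * u y i + k * (coord i y * divergence u y)) Ω := by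
    refine analyticOnNhd_of_lapl_eq_zero hΩ
      ((contDiffOn_const.mul (hu i)).add (contDiffOn_const.mul (hX.mul hθ))) fun x hx => ?_
    rw [lapl_add hΩ (contDiffOn_const.mul (hu i)) (contDiffOn_const.mul (hX.mul hθ)) hx,
      lapl_const_mul hΩ (hu i) hx, lapl_const_mul hΩ (hX.mul hθ) hx, lapl_coord_mul hΩ hθ hx,
      hE.lapl_divergence_eq_zero hΩ hu hmk hx]
    linear_combination 2 * hE i x hx
  intro x hx
  have h1 : AnalyticAt ℝ (fun y => (2 * m)⁻¹ * ((2 * m * u y i +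
      k * (coord i y * divergence u y)) - k * (coord i y * divergence u y))) x :=
    analyticAt_const.mul ((hh x hx).sub (analyticAt_const.mul (analyticAt_coord.mul (hθa x hx))))
  refine h1.congr (Eventually.of_forall fun y => ?_)
  simp only
  field_simp
  ring

end Analyticity

/-! ### Equivalence of the weak and pointwise equations for smooth fields. -/

section WeakForm

variable {u φ : Field2} {Ω : Set Plane} {lam mu : ℝ}

/-- Green's identity for the Lamé operator. -/
theorem integral_mul_lameOp (hΩ : IsOpen Ω) (hu : SmoothField u Ω) (hφ : ContDiff ℝ ∞ φ)
    (hφc : HasCompactSupport φ) (hφΩ : tsupport φ ⊆ Ω) :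
    ∫ x in Ω, ∑ i, u x i * lameOp lam mu φ x i =
      ∫ x, ∑ i, ((mu : ℂ) * lapl (fun y => u y i) x +
        ((lam + mu : ℝ) : ℂ) * pd i (divergence u) x) * φ x i := by
  have hφi (i) : ContDiff ℝ ∞ fun y => φ y i := contDiff_pi.1 hφ i
  have hφs (i) : tsupport (fun y => φ y i) ⊆ tsupport φ :=
    closure_mono fun x hx h => hx (by simp [h])
  have hφci (i) : HasCompactSupport fun y => φ y i :=
    hφc.of_isClosed_subset (isClosed_tsupport _) (hφs i)
  have hφΩi (i) := (hφs i).trans hφΩ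
  have hI (i j a b) : Integrable fun x => u x i * pd a (pd b fun y => φ y j) x :=
    integrable_mul_of_tsupport_subset hΩ (hu i).continuousOn
      (contDiff_pd (contDiff_pd (hφi j))).continuous
      (hasCompactSupport_pd (hasCompactSupport_pd (hφci j)))
      (tsupport_pd_subset.trans (tsupport_pd_subset.trans (hφΩi j)))
  have hJ (i j a b) : Integrable fun x => pd a (pd b fun y => u y i) x * φ x j :=
    integrable_mul_of_tsupport_subset hΩ (smoothOn_pd hΩ (smoothOn_pd hΩ (hu i))).continuousOn
      (hφi j).continuous (hφci j) (hφΩi j)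
  have hIJ (i j a b) : ∫ x, u x i * pd a (pd b fun y => φ y j) x =
      ∫ x, pd b (pd a fun y => u y i) x * φ x j :=
    integral_mul_pd_pd hΩ (hu i) (hφi j) (hφci j) (hφΩi j)
  have hz (i j a b) : ∀ x ∉ Ω, u x i * pd a (pd b fun y => φ y j) x = 0 := fun x hx => by
    rw [image_eq_zero_of_notMem_tsupport fun h => hx (hφΩi j
      (tsupport_pd_subset (tsupport_pd_subset h))), mul_zero]
  have hL (x) : ∑ i, u x i * lameOp lam mu φ x i =
      ∑ i, ∑ a, ((mu : ℂ) * (u x i * pd a (pd a fun y => φ y i) x) +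
        ((lam + mu : ℝ) : ℂ) * (u x i * pd i (pd a fun y => φ y a) x)) := by
    refine Finset.sum_congr rfl fun i _ => ?_
    have hd : pd i (divergence φ) x = _ := pd_add isOpen_univ
      (contDiff_pd (j := 0) (hφi 0)).contDiffOn (contDiff_pd (j := 1) (hφi 1)).contDiffOn
      (mem_univ x)
    rw [lameOp_eq isOpen_univ (fun i => (hφi i).contDiffOn) (mem_univ x), hd, lapl,
      Fin.sum_univ_two]
    ring
  -- In the divergence term the two summation indices are interchanged, so that each summand is the
  -- result of integrating by parts twice in the matching summand of `hL`.
  have hR : EqOn (fun x => ∑ i, ((mu : ℂ) * lapl (fun y => u y i) x +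
        ((lam + mu : ℝ) : ℂ) * pd i (divergence u) x) * φ x i)
      (fun x => ∑ i, ∑ a, ((mu : ℂ) * (pd a (pd a fun y => u y i) x * φ x i) +
        ((lam + mu : ℝ) : ℂ) * (pd a (pd i fun y => u y i) x * φ x a))) univ := by
    intro x _
    by_cases hx : x ∈ Ω
    · have hd (i) : pd i (divergence u) x = _ :=
        pd_add hΩ (smoothOn_pd (j := 0) hΩ (hu 0)) (smoothOn_pd (j := 1) hΩ (hu 1)) hx
      simp only [Fin.sum_univ_two, hd, lapl]
      ring
    · have h0 : φ x = 0 := image_eq_zero_of_notMem_tsupport fun h => hx (hφΩ h)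
      simp [h0]
  rw [setIntegral_eq_integral_of_forall_compl_eq_zero, integral_congr_ae (.of_forall hL),
    integral_congr_ae (.of_forall fun x => hR (mem_univ x))]
  · have hI' (i a) : Integrable fun x : Plane => (_ : ℂ) := ((hI i i a a).const_mul (mu : ℂ)).add
      ((hI i a i a).const_mul ((lam + mu : ℝ) : ℂ))
    have hJ' (i a) : Integrable fun x : Plane => (_ : ℂ) := ((hJ i i a a).const_mul (mu : ℂ)).add
      ((hJ i a a i).const_mul ((lam + mu : ℝ) : ℂ))
    simp only [Pi.add_apply] at hI' hJ' ⊢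
    rw [integral_finsetSum _ fun i _ => integrable_finsetSum _ fun a _ => hI' i a,
      integral_finsetSum _ fun i _ => integrable_finsetSum _ fun a _ => hJ' i a]
    refine Finset.sum_congr rfl fun i _ => ?_
    rw [integral_finsetSum _ fun a _ => hI' i a, integral_finsetSum _ fun a _ => hJ' i a]
    refine Finset.sum_congr rfl fun a _ => ?_
    rw [integral_add ((hI i i a a).const_mul _) ((hI i a i a).const_mul _),
      integral_add ((hJ i i a a).const_mul _) ((hJ i a a i).const_mul _)]
    simp only [integral_const_mul, hIJ]
  · intro x hx
    rw [hL]
    exact Finset.sum_eq_zero fun i _ => Finset.sum_eq_zero fun a _ => by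
      rw [hz _ _ _ _ x hx, hz _ _ _ _ x hx]; simp

/-- A smooth weak solution solves the equation pointwise. -/
theorem pointwiseLame_of_weak (hΩ : IsOpen Ω) (hu : SmoothField u Ω)
    (hw : ∀ φ : Field2, ContDiff ℝ ∞ φ → HasCompactSupport φ → tsupport φ ⊆ Ω →
      ∫ x in Ω, ∑ i, u x i * lameOp lam mu φ x i = 0) :
    PointwiseLame (mu : ℂ) ((lam + mu : ℝ) : ℂ) u Ω := by
  intro i
  have hc : ContinuousOn (fun x => (mu : ℂ) * lapl (fun y => u y i) x +
      ((lam + mu : ℝ) : ℂ) * pd i (divergence u) x) Ω :=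
    (continuousOn_const.mul (smoothOn_lapl hΩ (hu i)).continuousOn).add
      (continuousOn_const.mul (smoothOn_pd hΩ (smoothOn_divergence hΩ hu)).continuousOn)
  have h0 := hΩ.ae_eq_zero_of_integral_contDiff_smul_eq_zero
    (hc.locallyIntegrableOn hΩ.measurableSet (μ := volume)) fun g hg hgc hgΩ => ?_
  · exact Measure.eqOn_open_of_ae_eq ((ae_restrict_iff' hΩ.measurableSet).2 h0) hΩ hc
      continuousOn_const
  · let φ : Field2 := fun x => Pi.single i ((g x : ℝ) : ℂ)
    have hφs : Function.support φ ⊆ Function.support g := fun x hx h => hx (by simp [φ, h])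
    have hφ : ContDiff ℝ ∞ φ := contDiff_pi.2 fun j => by
      by_cases hij : j = i
      · subst hij
        simpa [φ, Function.comp_def] using Complex.ofRealCLM.contDiff.comp hg
      · simpa [φ, hij] using contDiff_const
    have h1 := hw φ hφ (hgc.mono hφs) ((closure_mono hφs).trans hgΩ)
    rw [integral_mul_lameOp hΩ hu hφ (hgc.mono hφs) ((closure_mono hφs).trans hgΩ)] at h1
    rw [← h1]
    refine integral_congr_ae (.of_forall fun x => ?_)
    simp only [φ]
    rw [Finset.sum_eq_single i (fun j _ hj => by simp [hj]) (by simp)]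
    simp [mul_comm, mul_add]

/-- A smooth pointwise solution is a weak solution. -/
theorem PointwiseLame.weak (hΩ : IsOpen Ω) (hu : SmoothField u Ω)
    (hE : PointwiseLame (mu : ℂ) ((lam + mu : ℝ) : ℂ) u Ω) (hφ : ContDiff ℝ ∞ φ)
    (hφc : HasCompactSupport φ) (hφΩ : tsupport φ ⊆ Ω) :
    ∫ x in Ω, ∑ i, u x i * lameOp lam mu φ x i = 0 := by
  rw [integral_mul_lameOp hΩ hu hφ hφc hφΩ]
  refine integral_eq_zero_of_ae (.of_forall fun x => Finset.sum_eq_zero fun i _ => ?_)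
  by_cases hx : x ∈ Ω
  · rw [hE i x hx, zero_mul]
  · rw [image_eq_zero_of_notMem_tsupport fun h => hx (hφΩ h)]
    simp

end WeakForm

/-! ### The Laplacian of radial functions. -/

section Radial

/-- The operator `4 (s g')'`, which is the Laplacian in the variable `s = ‖y - c‖²`. -/
def radLap (g : ℝ → ℝ) (s : ℝ) : ℝ := 4 * deriv (fun t => t * deriv g t) s

/-- The function `y ↦ g (‖y - c‖²)`. -/
def radial (c : Plane) (g : ℝ → ℝ) (y : Plane) : ℂ := ((g (‖y - c‖ ^ 2) : ℝ) : ℂ)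

variable {g : ℝ → ℝ}

theorem contDiff_deriv (hg : ContDiff ℝ ∞ g) : ContDiff ℝ ∞ (deriv g) :=
  (contDiff_infty_iff_deriv.1 hg).2

theorem hasDerivAt_deriv_of_contDiff (hg : ContDiff ℝ ∞ g) (s : ℝ) : HasDerivAt g (deriv g s) s :=
  (hg.differentiable (by simp) s).hasDerivAt

theorem radLap_eq (hg : ContDiff ℝ ∞ g) (s : ℝ) :
    radLap g s = 4 * (deriv g s + s * deriv (deriv g) s) := by
  have := (hasDerivAt_id s).mul (hasDerivAt_deriv_of_contDiff (contDiff_deriv hg) s)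
  rw [radLap, HasDerivAt.deriv (f := fun t => t * deriv g t) this]
  simp

theorem contDiff_radLap (hg : ContDiff ℝ ∞ g) : ContDiff ℝ ∞ (radLap g) := by
  have : radLap g = fun s => 4 * (deriv g s + s * deriv (deriv g) s) := funext (radLap_eq hg)
  rw [this]
  exact contDiff_const.mul ((contDiff_deriv hg).add
    (contDiff_id.mul (contDiff_deriv (contDiff_deriv hg))))

/-- Meant for rescaling s log s: the logarithm produces a linear term `q * t`, which contributes
only a constant to `radLap` and is killed by a second application. -/
theorem radLap_scale (hg : ContDiff ℝ ∞ g) (b p q d s : ℝ) :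
    radLap (fun t => b * g (p * t) + q * t + d) s = b * p * radLap g (p * s) + 4 * q := by
  have hp (t : ℝ) : HasDerivAt (fun t => p * t) p t := by
    simpa using (hasDerivAt_id t).const_mul p
  have h1 {f : ℝ → ℝ} (hf : ContDiff ℝ ∞ f) (t : ℝ) :
      HasDerivAt (fun t => f (p * t)) (deriv f (p * t) * p) t :=
    (hasDerivAt_deriv_of_contDiff hf (p * t)).comp t (hp t)
  have h2 : deriv (fun t => b * g (p * t) + q * t + d) = fun t => b * (deriv g (p * t) * p) + q := by
    ext t
    have := ((h1 hg t).const_mul b).add ((hasDerivAt_id t).const_mul q) |>.add_const d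
    simpa [Pi.add_def] using this.deriv
  have h3 : deriv (deriv fun t => b * g (p * t) + q * t + d) s =
      b * (deriv (deriv g) (p * s) * p * p) := by
    rw [h2]
    exact ((((h1 (contDiff_deriv hg) s).mul_const p).const_mul b).add_const q).deriv
  have hs : ContDiff ℝ ∞ fun t => b * g (p * t) + q * t + d :=
    ((contDiff_const.mul (hg.comp (contDiff_const.mul contDiff_id))).add
      (contDiff_const.mul contDiff_id)).add contDiff_const
  rw [radLap_eq hs, h3, h2, radLap_eq hg]
  ring

theorem contDiff_radial (c : Plane) (hg : ContDiff ℝ ∞ g) : ContDiff ℝ ∞ (radial c g) :=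
  Complex.ofRealCLM.contDiff.comp (hg.comp ((contDiff_id.sub contDiff_const).norm_sq ℝ))

theorem pd_radial (c : Plane) (hg : ContDiff ℝ ∞ g) (j : Fin 2) (y : Plane) :
    pd j (radial c g) y = 2 * ((y j - c j : ℝ) : ℂ) * radial c (deriv g) y := by
  have h1 : HasFDerivAt (fun y : Plane => ‖y - c‖ ^ 2) _ y :=
    ((hasFDerivAt_id y).sub_const c).norm_sq
  have h2 : HasFDerivAt (radial c g) _ y := Complex.ofRealCLM.hasFDerivAt.comp y
    ((hasDerivAt_deriv_of_contDiff hg (‖y - c‖ ^ 2)).comp_hasFDerivAt y h1)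
  rw [pd, h2.fderiv]
  simp [radial, EuclideanSpace.inner_single_right]
  ring

/-- Chain rule with s = ‖y - c‖²: in the plane |∇s|² = 4s and Δs = 4. -/
theorem lapl_radial (c : Plane) (hg : ContDiff ℝ ∞ g) (y : Plane) :
    lapl (radial c g) y = radial c (radLap g) y := by
  have hX (j) : ContDiffOn ℝ ∞ (fun y => coord j y - coord j c) univ :=
    (contDiff_coord.sub contDiff_const).contDiffOn
  have h1 (j) : EqOn (pd j (radial c g))
      (fun y => 2 * ((coord j y - coord j c) * radial c (deriv g) y)) univ := fun z _ => by
    rw [pd_radial c hg]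
    simp [coord]
    ring
  have hr := (contDiff_radial c (contDiff_deriv hg)).contDiffOn (s := univ)
  have h2 (j) : pd j (pd j (radial c g)) y = 2 * ((y j - c j : ℝ) : ℂ) *
      (2 * ((y j - c j : ℝ) : ℂ) * radial c (deriv (deriv g)) y) + 2 * radial c (deriv g) y := by
    rw [pd_eqOn isOpen_univ (h1 j) (mem_univ y),
      pd_const_mul isOpen_univ ((hX j).mul hr) (mem_univ y),
      pd_mul isOpen_univ (hX j) hr (mem_univ y), pd_radial c (contDiff_deriv hg),
      pd_sub isOpen_univ contDiff_coord.contDiffOn contDiffOn_const (mem_univ y), pd_coord]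
    simp [pd, coord]
    ring
  have h3 : ‖y - c‖ ^ 2 = (y 0 - c 0) ^ 2 + (y 1 - c 1) ^ 2 := by
    simp [EuclideanSpace.norm_sq_eq]
  rw [lapl, h2, h2, radial, radial, radial, radLap_eq hg]
  generalize hn : ‖y - c‖ ^ 2 = n at *
  subst h3
  push_cast
  ring

end Radial

/-! ### A regularised fundamental solution of Δ² and its compactly supported bilaplacian. -/

section Kernel

/-- A smooth function that equals `s log s` for `s ≥ 1` and vanishes for `s ≤ 1/2`. In the variable
`s = ‖y‖²` it is a regularisation of the fundamental solution of the bilaplacian. -/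
def smoothLog (s : ℝ) : ℝ := Real.smoothTransition (2 * s - 1) * (s * Real.log s)

theorem smoothLog_of_one_le {s : ℝ} (hs : 1 ≤ s) : smoothLog s = s * Real.log s := by
  rw [smoothLog, Real.smoothTransition.one_of_one_le (by linarith), one_mul]

theorem smoothLog_of_le {s : ℝ} (hs : s ≤ 1 / 2) : smoothLog s = 0 := by
  rw [smoothLog, Real.smoothTransition.zero_of_nonpos (by linarith), zero_mul]

theorem contDiff_smoothLog : ContDiff ℝ ∞ smoothLog := by
  rw [contDiff_iff_contDiffAt]
  intro s
  rcases lt_or_ge s (1 / 2) with hs | hs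
  · refine (contDiffAt_const (c := (0 : ℝ))).congr_of_eventuallyEq ?_
    filter_upwards [Iio_mem_nhds hs] with t ht using smoothLog_of_le ht.le
  · exact (Real.smoothTransition.contDiff.comp
      ((contDiff_const.mul contDiff_id).sub contDiff_const)).contDiffAt.mul
      (contDiffAt_id.mul (Real.contDiffAt_log.2 (by positivity)))

theorem radLap_smoothLog {s : ℝ} (hs : 1 < s) : radLap smoothLog s = 4 * (Real.log s + 2) := by
  have hs0 : s ≠ 0 := by positivity
  have h1 {t : ℝ} (ht : 1 < t) : deriv smoothLog t = Real.log t + 1 := by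
    have h : smoothLog =ᶠ[𝓝 t] fun t => t * Real.log t := by
      filter_upwards [Ioi_mem_nhds ht] with t ht using smoothLog_of_one_le (le_of_lt ht)
    rw [h.deriv_eq]
    exact Real.deriv_mul_log (by positivity)
  have h2 : deriv smoothLog =ᶠ[𝓝 s] fun t => Real.log t + 1 := by
    filter_upwards [Ioi_mem_nhds hs] with t ht using h1 ht
  rw [radLap_eq contDiff_smoothLog, h1 hs, h2.deriv_eq,
    ((Real.hasDerivAt_log hs0).add_const 1).deriv]
  field_simp
  ring

/-- The function `W` with `Δ² (smoothLog ‖y‖²) = W (‖y‖²)`. -/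
def kernelProfile : ℝ → ℝ := radLap (radLap smoothLog)

theorem contDiff_kernelProfile : ContDiff ℝ ∞ kernelProfile :=
  contDiff_radLap (contDiff_radLap contDiff_smoothLog)

theorem deriv_radLap_smoothLog {s : ℝ} (hs : 1 < s) : deriv (radLap smoothLog) s = 4 / s := by
  have h : radLap smoothLog =ᶠ[𝓝 s] fun t => 4 * (Real.log t + 2) := by
    filter_upwards [Ioi_mem_nhds hs] with t ht using radLap_smoothLog ht
  rw [h.deriv_eq, (((Real.hasDerivAt_log (by positivity)).add_const 2).const_mul 4).deriv]
  ring

/-- Beyond s = 1, `radLap smoothLog` is 4(log s + 2), which is harmonic in the plane: s times its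
derivative is constant. -/
theorem kernelProfile_of_one_lt {s : ℝ} (hs : 1 < s) : kernelProfile s = 0 := by
  have h : (fun t => t * deriv (radLap smoothLog) t) =ᶠ[𝓝 s] fun _ => 4 := by
    filter_upwards [Ioi_mem_nhds hs] with t ht
    have ht0 : t ≠ 0 := (zero_lt_one.trans ht).ne'
    rw [deriv_radLap_smoothLog ht]
    field_simp
  rw [kernelProfile, radLap, h.deriv_eq]
  simp

/-- The bilaplacian of the regularised fundamental solution. -/
def kernel (z : Plane) : ℂ := radial 0 kernelProfile z

theorem contDiff_kernel : ContDiff ℝ ∞ kernel := contDiff_radial 0 contDiff_kernelProfile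

theorem kernel_eq_zero {z : Plane} (hz : 1 < ‖z‖) : kernel z = 0 := by
  rw [kernel, radial, kernelProfile_of_one_lt (by simpa using one_lt_pow₀ hz two_ne_zero)]
  simp

theorem support_kernel_subset : Function.support kernel ⊆ Metric.closedBall 0 1 := fun z hz => by
  by_contra h
  exact hz (kernel_eq_zero (by simpa using h))

theorem hasCompactSupport_kernel : HasCompactSupport kernel :=
  .of_support_subset_isCompact (isCompact_closedBall 0 1) support_kernel_subset

/-- In polar coordinates the integrand is an exact derivative, so the radial integral is the
boundary value 2·y²·(4/y²) = 8 at infinity. The reproducing formula divides by this integral. -/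
theorem integral_kernel_ne_zero : ∫ z, kernel z ≠ 0 := by
  have h1 : ∫ y in Ioi (0 : ℝ), y * kernelProfile (y ^ 2) = 8 := by
    have hd (y : ℝ) : HasDerivAt (fun y => 2 * (y ^ 2 * deriv (radLap smoothLog) (y ^ 2)))
        (y * kernelProfile (y ^ 2)) y := by
      have hK := contDiff_deriv (contDiff_radLap contDiff_smoothLog)
      have h2 := (hasDerivAt_deriv_of_contDiff (contDiff_id.mul hK) (y ^ 2)).comp y
        (hasDerivAt_pow 2 y)
      refine (h2.const_mul 2).congr_deriv ?_
      rw [kernelProfile, radLap]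
      simp only [id]
      push_cast
      ring
    have hc : Continuous fun y : ℝ => y * kernelProfile (y ^ 2) :=
      continuous_id.mul (contDiff_kernelProfile.continuous.comp (continuous_pow 2))
    have hi : Integrable fun y : ℝ => y * kernelProfile (y ^ 2) := by
      refine hc.integrable_of_hasCompactSupport
        (.of_support_subset_isCompact (isCompact_Icc (a := -1) (b := 1)) fun y hy => ?_)
      by_contra h
      refine hy ?_
      have : 1 < y ^ 2 := by
        rw [one_lt_sq_iff_one_lt_abs]
        by_contra h'
        exact h (abs_le.1 (not_lt.1 h'))
      simp [kernelProfile_of_one_lt this]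
    have ht : Tendsto (fun y : ℝ => 2 * (y ^ 2 * deriv (radLap smoothLog) (y ^ 2))) atTop
        (𝓝 8) := by
      refine tendsto_const_nhds.congr' ?_
      filter_upwards [eventually_gt_atTop 1] with y hy
      have : y ≠ 0 := by positivity
      rw [deriv_radLap_smoothLog (one_lt_pow₀ hy two_ne_zero)]
      field_simp
      norm_num
    rw [integral_Ioi_of_hasDerivAt_of_tendsto (hd 0).continuousAt.continuousWithinAt
      (fun y _ => hd y) hi.integrableOn ht]
    simp
  have h2 : ∫ z : Plane, kernelProfile (‖z‖ ^ 2) =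
      2 * ((volume : Measure Plane).real (Metric.ball 0 1) * 8) := by
    rw [integral_fun_norm_addHaar volume fun y => kernelProfile (y ^ 2)]
    simp [h1]
  have h3 : ∫ z, kernel z = ((∫ z : Plane, kernelProfile (‖z‖ ^ 2) : ℝ) : ℂ) := by
    rw [← integral_complex_ofReal]
    simp [kernel, radial]
  have h4 : 0 < (volume : Measure Plane).real (Metric.ball 0 1) :=
    ENNReal.toReal_pos (Metric.measure_ball_pos volume _ one_pos).ne' measure_ball_lt_top.ne
  rw [h3, h2]
  exact_mod_cast (by positivity : 2 * ((volume : Measure Plane).real (Metric.ball 0 1) * 8) ≠ 0)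

/-- The rescaled kernel `δ⁻² ψ (δ⁻¹ (y - c))`. -/
def scaledKernel (δ : ℝ) (c y : Plane) : ℂ := ((δ⁻¹ ^ 2 : ℝ) : ℂ) * kernel (δ⁻¹ • (y - c))

/-- Two regularisations of the fundamental solution differ by a function supported in a ball, so
the corresponding rescaled kernels differ by the bilaplacian of a test function. -/
theorem exists_lapl_lapl_eq_scaledKernel_sub {δ r : ℝ} (hδ : 0 < δ) (hr : δ ≤ r) (c : Plane) :
    ∃ η : Plane → ℂ, ContDiff ℝ ∞ η ∧ Function.support η ⊆ Metric.closedBall c r ∧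
      ∀ y, lapl (lapl η) y = scaledKernel δ c y - scaledKernel r c y := by
  -- Since e²·(t/e²)·log(t/e²) = t log t - t log e², the linear correction makes `K e t` equal to t
  -- log t for all t ≥ e², whatever e is. The final `+ 0` fits the shape of `radLap_scale`.
  let K : ℝ → ℝ → ℝ := fun e t => e ^ 2 * smoothLog ((e ^ 2)⁻¹ * t) + Real.log (e ^ 2) * t + 0
  have hK (e) : ContDiff ℝ ∞ (K e) :=
    ((contDiff_const.mul (contDiff_smoothLog.comp (contDiff_const.mul contDiff_id))).add
      (contDiff_const.mul contDiff_id)).add contDiff_const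
  have hKl {e t : ℝ} (he : 0 < e) (ht : e ^ 2 ≤ t) : K e t = t * Real.log t := by
    have he2 : 0 < e ^ 2 := by positivity
    have h1 : 1 ≤ (e ^ 2)⁻¹ * t := by
      rw [inv_mul_eq_div, one_le_div he2]
      exact ht
    have ht0 : t ≠ 0 := (he2.trans_le ht).ne'
    simp only [K]
    rw [smoothLog_of_one_le h1, Real.log_mul (inv_ne_zero he2.ne') ht0, Real.log_inv]
    field_simp
    ring
  have hKK {e : ℝ} (he : 0 < e) (t : ℝ) :
      radLap (radLap (K e)) t = (e ^ 2)⁻¹ * kernelProfile ((e ^ 2)⁻¹ * t) := by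
    have he2 : e ^ 2 ≠ 0 := by positivity
    have h1 : radLap (K e) =
        fun t => 1 * radLap smoothLog ((e ^ 2)⁻¹ * t) + 0 * t + 4 * Real.log (e ^ 2) := by
      ext t
      simp only [K]
      rw [radLap_scale contDiff_smoothLog, mul_inv_cancel₀ he2]
      ring
    rw [h1, radLap_scale (contDiff_radLap contDiff_smoothLog), kernelProfile]
    ring
  refine ⟨fun y => radial c (K δ) y + (-1) * radial c (K r) y,
    (contDiff_radial c (hK _)).add (contDiff_const.mul (contDiff_radial c (hK _))), fun y hy => ?_, fun y => ?_⟩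
  · by_contra h
    have hyr : r < ‖y - c‖ := by simpa [dist_eq_norm] using h
    have hr2 : r ^ 2 ≤ ‖y - c‖ ^ 2 := by gcongr; linarith
    have hδ2 : δ ^ 2 ≤ ‖y - c‖ ^ 2 := le_trans (by gcongr) hr2
    exact hy (by simp [radial, hKl hδ hδ2, hKl (hδ.trans_le hr) hr2])
  · have h1 {p q : ℝ → ℝ} (hp : ContDiff ℝ ∞ p) (hq : ContDiff ℝ ∞ q) :
        lapl (fun y => radial c p y + (-1) * radial c q y) =
          fun y => radial c (radLap p) y + (-1) * radial c (radLap q) y := by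
      ext y
      have hp' := (contDiff_radial c hp).contDiffOn (s := univ)
      have hq' := (contDiff_radial c hq).contDiffOn (s := univ)
      rw [lapl_add isOpen_univ hp' (contDiffOn_const.mul hq') (mem_univ y),
        lapl_const_mul isOpen_univ hq' (mem_univ y), lapl_radial c hp, lapl_radial c hq]
    have h2 {e : ℝ} (he : 0 < e) :
        radial c (radLap (radLap (K e))) y = scaledKernel e c y := by
      rw [radial, hKK he, scaledKernel, kernel, radial]
      simp [norm_smul, mul_pow]
    rw [h1 (hK δ) (hK r), h1 (contDiff_radLap (hK δ)) (contDiff_radLap (hK r))]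
    beta_reduce
    rw [h2 hδ, h2 (hδ.trans_le hr)]
    ring

end Kernel

/-! ### Weak solutions are smooth: a Weyl lemma for the bilaplacian. -/

section Regularity

variable {u : Field2} {f : Plane → ℂ} {Ω : Set Plane} {lam mu : ℝ}

theorem tsupport_lapl_subset {η : Plane → ℂ} : tsupport (lapl η) ⊆ tsupport η := by
  refine closure_minimal (fun x hx => ?_) (isClosed_tsupport _)
  by_contra h
  refine hx ?_
  rw [lapl, image_eq_zero_of_notMem_tsupport fun h' => h (tsupport_pd_subset
    (tsupport_pd_subset h')), image_eq_zero_of_notMem_tsupport fun h' => h (tsupport_pd_subset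
    (tsupport_pd_subset h')), add_zero]

/-- The components of a weak solution of the Lamé system are weakly biharmonic. -/
theorem integral_mul_lapl_lapl_eq_zero (hmu : 0 < mu) (hlam : 0 < lam + 2 * mu)
    (hw : ∀ φ : Field2, ContDiff ℝ ∞ φ → HasCompactSupport φ → tsupport φ ⊆ Ω →
      ∫ x in Ω, ∑ i, u x i * lameOp lam mu φ x i = 0) (i : Fin 2) {η : Plane → ℂ}
    (hη : ContDiff ℝ ∞ η) (hηc : HasCompactSupport η) (hηΩ : tsupport η ⊆ Ω) :
    ∫ x, u x i * lapl (lapl η) x = 0 := by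
  have hO : IsOpen (univ : Set Plane) := isOpen_univ
  have hη' := hη.contDiffOn (s := univ)
  have hl := smoothOn_lapl hO hη'
  let a : ℂ := ((lam + 2 * mu : ℝ) : ℂ)
  let b : ℂ := ((lam + mu : ℝ) : ℂ)
  -- The i-th column of the adjugate of the Lamé operator, (λ+2μ)Δη eᵢ - (λ+μ)∇∂ᵢη, which `lameOp`
  -- sends to μ(λ+2μ)Δ²η eᵢ.
  let φ : Field2 := fun x j => (if j = i then a else 0) * lapl η x + -b * pd j (pd i η) x
  have hd (j) : ContDiffOn ℝ ∞ (pd j (pd i η)) univ := smoothOn_pd hO (smoothOn_pd hO hη')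
  have hφi : SmoothField φ univ := fun j =>
    (contDiffOn_const.mul hl).add (contDiffOn_const.mul (hd j))
  have hφ : ContDiff ℝ ∞ φ := contDiff_pi.2 fun j => contDiffOn_univ.1 (hφi j)
  have hφs : tsupport φ ⊆ tsupport η := by
    refine closure_minimal (fun x hx => ?_) (isClosed_tsupport _)
    by_contra h
    refine hx (funext fun j => ?_)
    simp only [φ]
    rw [image_eq_zero_of_notMem_tsupport fun h' => h (tsupport_lapl_subset h'),
      image_eq_zero_of_notMem_tsupport fun h' => h (tsupport_pd_subset (tsupport_pd_subset h'))]
    simp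
  have hdiv (x) : divergence φ x = (mu : ℂ) * pd i (lapl η) x := by
    have h1 (j) : pd j (fun y => φ y j) x =
        (if j = i then a else 0) * pd j (lapl η) x + -b * pd j (pd j (pd i η)) x := by
      simp only [φ]
      rw [pd_add hO (contDiffOn_const.mul hl) (contDiffOn_const.mul (hd j)) (mem_univ x),
        pd_const_mul hO hl (mem_univ x), pd_const_mul hO (hd j) (mem_univ x)]
    have h2 := pd_lapl (j := i) hO hη' (mem_univ x)
    have h3 : lapl (pd i η) x = pd 0 (pd 0 (pd i η)) x + pd 1 (pd 1 (pd i η)) x := rfl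
    have hab : a = b + mu := by simp only [a, b]; push_cast; ring
    rw [divergence, h1, h1]
    fin_cases i
    · simp at h2 h3 ⊢
      linear_combination b * h2 + b * h3 + pd 0 (lapl η) x * hab
    · simp at h2 h3 ⊢
      linear_combination b * h2 + b * h3 + pd 1 (lapl η) x * hab
  have hL (x j) : lameOp lam mu φ x j = if j = i then mu * a * lapl (lapl η) x else 0 := by
    have h1 : pd j (divergence φ) x = mu * pd j (pd i (lapl η)) x := by
      rw [funext hdiv, pd_const_mul hO (smoothOn_pd hO hl) (mem_univ x)]
    have h2 : lapl (pd j (pd i η)) x = pd j (pd i (lapl η)) x := by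
      rw [← pd_lapl hO (smoothOn_pd hO hη') (mem_univ x)]
      exact pd_eqOn hO (fun y hy => (pd_lapl hO hη' hy).symm) (mem_univ x)
    rw [lameOp_eq hO hφi (mem_univ x), h1]
    simp only [φ]
    rw [lapl_add hO (contDiffOn_const.mul hl) (contDiffOn_const.mul (hd j)) (mem_univ x),
      lapl_const_mul hO hl (mem_univ x), lapl_const_mul hO (hd j) (mem_univ x), h2]
    split_ifs <;> ring
  have h := hw φ hφ (hηc.of_isClosed_subset (isClosed_tsupport _) hφs) (hφs.trans hηΩ)
  have h2 (x) : ∑ j, u x j * lameOp lam mu φ x j = mu * a * (u x i * lapl (lapl η) x) := by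
    rw [Finset.sum_eq_single i (fun j _ hj => by simp [hL, hj]) (by simp), hL, if_pos rfl]
    ring
  simp only [h2] at h
  rw [integral_const_mul, setIntegral_eq_integral_of_forall_compl_eq_zero] at h
  · refine (mul_eq_zero.1 h).resolve_left (mul_ne_zero ?_ ?_)
    · exact_mod_cast hmu.ne'
    · exact Complex.ofReal_ne_zero.2 hlam.ne'
  · intro x hx
    rw [image_eq_zero_of_notMem_tsupport fun h' => hx (hηΩ (tsupport_lapl_subset
      (tsupport_lapl_subset h'))), mul_zero]

theorem support_scaledKernel_subset {δ : ℝ} (hδ : 0 < δ) (c : Plane) :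
    Function.support (scaledKernel δ c) ⊆ Metric.closedBall c δ := by
  intro y hy
  by_contra h
  refine hy ?_
  have h1 : 1 < ‖δ⁻¹ • (y - c)‖ := by
    rw [norm_smul, Real.norm_of_nonneg (by positivity), inv_mul_eq_div, one_lt_div hδ]
    simpa [dist_eq_norm] using h
  rw [scaledKernel, kernel_eq_zero h1, mul_zero]

theorem contDiff_scaledKernel (δ : ℝ) (c : Plane) : ContDiff ℝ ∞ (scaledKernel δ c) :=
  contDiff_const.mul (contDiff_kernel.comp
    ((contDiff_const_smul δ⁻¹).comp (contDiff_id.sub contDiff_const)))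

theorem integral_mul_scaledKernel {δ : ℝ} (hδ : 0 < δ) (c : Plane) (f : Plane → ℂ) :
    ∫ y, f y * scaledKernel δ c y = ∫ z, f (c + δ • z) * kernel z := by
  have h1 : ∀ y, f y * scaledKernel δ c y = ((δ⁻¹ ^ 2 : ℝ) : ℂ) *
      (fun z => (fun w => f (c + δ • w) * kernel w) (δ⁻¹ • z)) (y - c) := fun y => by
    simp only [scaledKernel, smul_inv_smul₀ hδ.ne', add_sub_cancel]
    ring
  simp only [h1]
  rw [integral_const_mul, integral_sub_right_eq_self (μ := volume)
    (fun z => (fun w => f (c + δ • w) * kernel w) (δ⁻¹ • z)) c,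
    Measure.integral_comp_smul volume (fun w => f (c + δ • w) * kernel w) δ⁻¹]
  have : (0 : ℝ) ≤ δ ^ 2 := by positivity
  have hδ' : (δ : ℂ) ≠ 0 := Complex.ofReal_ne_zero.2 hδ.ne'
  simp [abs_of_nonneg this]
  field_simp

/-- A continuous weakly biharmonic function is reproduced by the kernel. -/
theorem integral_mul_scaledKernel_eq (hΩ : IsOpen Ω) (hf : ContinuousOn f Ω)
    (hw : ∀ η : Plane → ℂ, ContDiff ℝ ∞ η → HasCompactSupport η → tsupport η ⊆ Ω →
      ∫ x, f x * lapl (lapl η) x = 0) {c : Plane} {r : ℝ} (hr : 0 < r)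
    (hc : Metric.closedBall c r ⊆ Ω) :
    ∫ y, f y * scaledKernel r c y = f c * ∫ z, kernel z := by
  have hI {δ : ℝ} (hδ : 0 < δ) (hδr : δ ≤ r) : Integrable fun y => f y * scaledKernel δ c y := by
    have hs : tsupport (scaledKernel δ c) ⊆ Metric.closedBall c δ :=
      closure_minimal (support_scaledKernel_subset hδ c) Metric.isClosed_closedBall
    exact integrable_mul_of_tsupport_subset hΩ hf (contDiff_scaledKernel δ c).continuous
      ((isCompact_closedBall c δ).of_isClosed_subset (isClosed_tsupport _) hs)
      (hs.trans ((Metric.closedBall_subset_closedBall hδr).trans hc))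
  -- Truncation gives a bounded, globally measurable function, as dominated convergence requires.
  let F : Plane → ℂ := (Metric.closedBall c r).indicator f
  have hfc : ContinuousOn f (Metric.closedBall c r) := hf.mono hc
  -- The integral at scale r equals the one at every smaller scale δ, because the kernels differ by
  -- Δ²η with η supported in the ball.
  have hFF {δ : ℝ} (hδ : 0 < δ) (hδr : δ ≤ r) :
      ∫ y, f y * scaledKernel r c y = ∫ z, F (c + δ • z) * kernel z := by
    obtain ⟨η, hη, hηs, hηl⟩ := exists_lapl_lapl_eq_scaledKernel_sub hδ hδr c
    have hηt : tsupport η ⊆ Metric.closedBall c r :=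
      closure_minimal hηs Metric.isClosed_closedBall
    have h0 := hw η hη ((isCompact_closedBall c r).of_isClosed_subset (isClosed_tsupport _) hηt)
      (hηt.trans hc)
    simp only [hηl, mul_sub] at h0
    rw [integral_sub (hI hδ hδr) (hI hr le_rfl), sub_eq_zero] at h0
    rw [← h0, ← integral_mul_scaledKernel hδ c F]
    refine integral_congr_ae (.of_forall fun y => ?_)
    by_cases hy : y ∈ Metric.closedBall c r
    · simp [F, hy]
    · have : scaledKernel δ c y = 0 := by
        by_contra h
        exact hy (Metric.closedBall_subset_closedBall hδr (support_scaledKernel_subset hδ c h))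
      simp [this]
  obtain ⟨M, hM⟩ := (isCompact_closedBall c r).exists_bound_of_continuousOn hfc
  have hM0 : 0 ≤ M := (norm_nonneg _).trans (hM c (Metric.mem_closedBall_self hr.le))
  have hFM (y) : ‖F y‖ ≤ M := by
    by_cases hy : y ∈ Metric.closedBall c r
    · simpa [F, hy] using hM y hy
    · simpa [F, hy] using hM0
  have hFm : AEStronglyMeasurable F volume :=
    (aestronglyMeasurable_indicator_iff Metric.isClosed_closedBall.measurableSet).2
      (hfc.aestronglyMeasurable Metric.isClosed_closedBall.measurableSet)
  have hFc : ContinuousAt F c := by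
    have h : f =ᶠ[𝓝 c] F := by
      filter_upwards [Metric.closedBall_mem_nhds c hr] with y hy
      simp only [F, indicator_of_mem hy]
    exact (hfc.continuousAt (Metric.closedBall_mem_nhds c hr)).congr h
  have hk : Integrable kernel :=
    contDiff_kernel.continuous.integrable_of_hasCompactSupport hasCompactSupport_kernel
  have hlim : Tendsto (fun δ : ℝ => ∫ z, F (c + δ • z) * kernel z) (𝓝[>] 0)
      (𝓝 (∫ z, F c * kernel z)) := by
    refine tendsto_integral_filter_of_dominated_convergence (fun z => M * ‖kernel z‖) ?_ ?_
      (hk.norm.const_mul M) (.of_forall fun z => ?_)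
    · filter_upwards [self_mem_nhdsWithin] with δ hδ
      have hδ' : δ ≠ 0 := ne_of_gt hδ
      have hq : Measure.QuasiMeasurePreserving (fun z : Plane => c + δ • z) volume volume := by
        have h1 : Measure.QuasiMeasurePreserving (fun z : Plane => δ • z) volume volume :=
          ⟨measurable_const_smul δ, by
            rw [Measure.map_addHaar_smul volume hδ']
            exact Measure.smul_absolutelyContinuous⟩
        exact (measurePreserving_add_left volume c).quasiMeasurePreserving.comp h1
      exact (hFm.comp_quasiMeasurePreserving hq).mul hk.aestronglyMeasurable
    · refine .of_forall fun δ => .of_forall fun z => ?_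
      rw [norm_mul]
      exact mul_le_mul_of_nonneg_right (hFM _) (norm_nonneg _)
    · have h1 : Tendsto (fun δ : ℝ => c + δ • z) (𝓝[>] 0) (𝓝 c) := by
        have : Continuous fun δ : ℝ => c + δ • z := by fun_prop
        simpa using this.continuousAt.tendsto.mono_left (nhdsWithin_le_nhds (a := (0 : ℝ)))
      exact (hFc.tendsto.comp h1).mul_const _
  have hconst : Tendsto (fun δ : ℝ => ∫ z, F (c + δ • z) * kernel z) (𝓝[>] 0)
      (𝓝 (∫ y, f y * scaledKernel r c y)) := by
    refine tendsto_const_nhds.congr' ?_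
    filter_upwards [Ioc_mem_nhdsGT hr] with δ hδ using hFF hδ.1 hδ.2
  rw [tendsto_nhds_unique hconst hlim, integral_const_mul]
  simp [F, hr.le]

/-- Continuous weakly biharmonic functions are smooth. -/
theorem smoothOn_of_weakly_biharmonic (hΩ : IsOpen Ω) (hf : ContinuousOn f Ω)
    (hw : ∀ η : Plane → ℂ, ContDiff ℝ ∞ η → HasCompactSupport η → tsupport η ⊆ Ω →
      ∫ x, f x * lapl (lapl η) x = 0) : ContDiffOn ℝ ∞ f Ω := by
  intro x hx
  obtain ⟨R, hR, hRΩ⟩ := Metric.nhds_basis_closedBall.mem_iff.1 (hΩ.mem_nhds hx)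
  -- Half the radius: for c within r of x, the ball of radius r about c stays in the ball of radius
  -- R, where the truncation agrees with `f`.
  let r := R / 2
  have hr : 0 < r := half_pos hR
  let F : Plane → ℂ := (Metric.closedBall x R).indicator f
  have hFi : Integrable F := (integrable_indicator_iff Metric.isClosed_closedBall.measurableSet).2
    ((hf.mono hRΩ).integrableOn_compact (isCompact_closedBall x R))
  have hsm : ContDiff ℝ ∞ (convolution F (scaledKernel r 0) (ContinuousLinearMap.mul ℝ ℂ) volume) :=
    HasCompactSupport.contDiff_convolution_right _
      (.of_support_subset_isCompact (isCompact_closedBall 0 r) (support_scaledKernel_subset hr 0))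
      hFi.locallyIntegrable (contDiff_scaledKernel r 0)
  have heq : ∀ c ∈ Metric.ball x r, f c = (∫ z, kernel z)⁻¹ *
      convolution F (scaledKernel r 0) (ContinuousLinearMap.mul ℝ ℂ) volume c := by
    intro c hc
    have hcR : Metric.closedBall c r ⊆ Metric.closedBall x R := by
      refine Metric.closedBall_subset_closedBall' ?_
      have := Metric.mem_ball.1 hc
      simp only [r] at this ⊢
      linarith
    have h := integral_mul_scaledKernel_eq hΩ hf hw hr (hcR.trans hRΩ)
    have h2 : convolution F (scaledKernel r 0) (ContinuousLinearMap.mul ℝ ℂ) volume c =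
        ∫ y, f y * scaledKernel r c y := by
      refine integral_congr_ae (.of_forall fun y => ?_)
      have hsym : scaledKernel r 0 (c - y) = scaledKernel r c y := by
        simp only [scaledKernel, kernel, radial, sub_zero, norm_smul, norm_sub_rev c y]
      simp only [ContinuousLinearMap.mul_apply', hsym]
      by_cases hy : y ∈ Metric.closedBall x R
      · simp only [F, indicator_of_mem hy]
      · have : scaledKernel r c y = 0 := by
          by_contra h
          exact hy (hcR (support_scaledKernel_subset hr c h))
        simp [this]
    rw [h2, h, mul_comm (f c), inv_mul_cancel_left₀ integral_kernel_ne_zero]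
  refine ContDiffAt.contDiffWithinAt ?_
  refine (contDiff_const.mul hsm).contDiffAt.congr_of_eventuallyEq
    (f := fun c => (∫ z, kernel z)⁻¹ * _) ?_
  filter_upwards [Metric.ball_mem_nhds x hr] with c hc using heq c hc

/-- Weak solutions of the Lamé system are smooth. -/
theorem IsLameSolution.smoothField {γ : Set Plane} (hmu : 0 < mu) (hlam : 0 < lam + 2 * mu)
    (hΩ : IsOpen Ω) (hu : IsLameSolution lam mu Ω γ u) : SmoothField u Ω := fun i =>
  smoothOn_of_weakly_biharmonic hΩ ((continuous_apply i).comp_continuousOn hu.continuousOn)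
    fun _ hη hηc hηΩ => integral_mul_lapl_lapl_eq_zero hmu hlam hu.weak_eq i hη hηc hηΩ

end Regularity

/-! ### Uniqueness for Cauchy data on the axis. -/

section CauchyUniqueness

variable {z : Field2} {f : Plane → ℂ} {Ω : Set Plane} {m k : ℂ} {p x : Plane} {r : ℝ}

/-- Linear combinations of solutions of the Lamé system are solutions. -/
theorem PointwiseLame.add_const_mul {v : Field2} (hΩ : IsOpen Ω) (hz : SmoothField z Ω)
    (hv : SmoothField v Ω) (hEz : PointwiseLame m k z Ω) (hEv : PointwiseLame m k v Ω) (a : ℂ) :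
    PointwiseLame m k (fun y i => z y i + a * v y i) Ω := by
  have hdv := smoothOn_divergence hΩ hv
  have hd : EqOn (divergence fun y i => z y i + a * v y i)
      (fun y => divergence z y + a * divergence v y) Ω := fun y hy => by
    simp only [divergence]
    rw [pd_add hΩ (hz 0) (contDiffOn_const.mul (hv 0)) hy, pd_const_mul hΩ (hv 0) hy,
      pd_add hΩ (hz 1) (contDiffOn_const.mul (hv 1)) hy, pd_const_mul hΩ (hv 1) hy]
    ring
  intro i y hy
  rw [pd_eqOn hΩ hd hy, pd_add hΩ (smoothOn_divergence hΩ hz) (contDiffOn_const.mul hdv) hy,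
    pd_const_mul hΩ hdv hy, lapl_add hΩ (hz i) (contDiffOn_const.mul (hv i)) hy,
    lapl_const_mul hΩ (hv i) hy]
  linear_combination hEz i y hy + a * hEv i y hy

/-- The field obtained by differentiating each component with respect to the first variable. -/
def pdField (z : Field2) : Field2 := fun y i => pd 0 (fun w => z w i) y

theorem SmoothField.pdField (hΩ : IsOpen Ω) (hz : SmoothField z Ω) : SmoothField (pdField z) Ω :=
  fun i => smoothOn_pd hΩ (hz i)

theorem PointwiseLame.pdField (hΩ : IsOpen Ω) (hz : SmoothField z Ω)
    (hE : PointwiseLame m k z Ω) : PointwiseLame m k (pdField z) Ω := by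
  have hd : EqOn (divergence (Lame.pdField z)) (pd 0 (divergence z)) Ω := fun y hy => by
    have h : pd 0 (divergence z) y = _ :=
      pd_add hΩ (smoothOn_pd (j := 0) hΩ (hz 0)) (smoothOn_pd (j := 1) hΩ (hz 1)) hy
    rw [h, pd_comm (i := 0) (j := 1) hΩ (hz 1) hy]
    rfl
  intro i y hy
  rw [pd_eqOn hΩ hd hy, pd_comm hΩ (smoothOn_divergence hΩ hz) hy, ← hE.pd_eq hΩ hz i 0 hy,
    pd_lapl hΩ (hz i) hy]
  rfl

/-- A tangential derivative of a function vanishing on the axis vanishes on the axis. -/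
theorem pd_one_eq_zero_of_axis (hb : Metric.ball p r ⊆ Ω) (hΩ : IsOpen Ω)
    (hf : ContDiffOn ℝ ∞ f Ω) (h : ∀ x ∈ Metric.ball p r, x 0 = 0 → f x = 0) :
    ∀ x ∈ Metric.ball p r, x 0 = 0 → pd 1 f x = 0 := by
  intro x hx hx0
  have h1 := ((differentiableAt_of_smoothOn hΩ hf (hb hx)).hasFDerivAt.hasLineDerivAt
    (EuclideanSpace.single 1 1))
  have h2 : (fun t : ℝ => f (x + t • EuclideanSpace.single 1 1)) =ᶠ[𝓝 0] fun _ => 0 := by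
    have hc : ContinuousAt (fun t : ℝ => x + t • (EuclideanSpace.single 1 1 : Plane)) 0 := by
      fun_prop
    have hm : Metric.ball p r ∈ 𝓝 (x + (0 : ℝ) • (EuclideanSpace.single 1 1 : Plane)) := by
      simpa using Metric.isOpen_ball.mem_nhds hx
    filter_upwards [hc hm] with t ht
    exact h _ ht (by simp [hx0])
  have h3 : HasDerivAt (fun t : ℝ => f (x + t • EuclideanSpace.single 1 1)) (pd 1 f x) 0 := h1
  rw [← h3.deriv, h2.deriv_eq]
  simp

/-- The axis is noncharacteristic: once z, ∂₁z and their tangential derivatives vanish there, the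
system reduces to (m + k)∂₁²z₁ = 0 and m ∂₁²z₂ = 0. -/
theorem pdField_pdField_eq_zero_of_axis (hb : Metric.ball p r ⊆ Ω) (hΩ : IsOpen Ω)
    (hz : SmoothField z Ω) (hE : PointwiseLame m k z Ω) (hm : m ≠ 0) (hmk : m + k ≠ 0)
    (h0 : ∀ x ∈ Metric.ball p r, x 0 = 0 → z x = 0)
    (h1 : ∀ x ∈ Metric.ball p r, x 0 = 0 → pdField z x = 0) :
    ∀ x ∈ Metric.ball p r, x 0 = 0 → pdField (pdField z) x = 0 := by
  intro x hx hx0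
  have hp (i j) := smoothOn_pd (j := j) hΩ (hz i)
  have a1 (i) := pd_one_eq_zero_of_axis hb hΩ (hz i) fun x hx hx0 => congrFun (h0 x hx hx0) i
  have a11 (i) := pd_one_eq_zero_of_axis hb hΩ (hp i 1) (a1 i) x hx hx0
  have a10 (i) := pd_one_eq_zero_of_axis hb hΩ (hp i 0)
    (fun x hx hx0 => congrFun (h1 x hx hx0) i) x hx hx0
  have hd (j) : pd j (divergence z) x = _ := pd_add hΩ (hp 0 0) (hp 1 1) (hb hx)
  have e (i) := hE i x (hb hx)
  have hc := pd_comm (i := 0) (j := 1) hΩ (hz 1) (hb hx)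
  funext i
  fin_cases i
  · change pd 0 (pd 0 fun w => z w 0) x = 0
    have e0 := e 0
    rw [hd, hc, a10, lapl, a11] at e0
    apply mul_left_cancel₀ hmk
    linear_combination e0
  · change pd 0 (pd 0 fun w => z w 1) x = 0
    have e1 := e 1
    rw [hd, a10, a11, lapl, a11] at e1
    apply mul_left_cancel₀ hm
    linear_combination e1

theorem eventuallyEq_zero_of_iteratedDeriv {h : ℝ → ℂ} {t : ℝ} (hh : AnalyticAt ℝ h t)
    (hd : ∀ n, iteratedDeriv n h t = 0) : h =ᶠ[𝓝 t] 0 := by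
  obtain ⟨q, ρ, hq⟩ := hh
  have hq0 : q = 0 := by
    ext1 n
    have h1 := hq.factorial_smul 1 n
    rw [← iteratedDeriv_eq_iteratedFDeriv, hd n] at h1
    refine FormalMultilinearSeries.coeff_eq_zero.1 ?_
    exact (smul_eq_zero.1 h1).resolve_left n.factorial_ne_zero
  subst hq0
  exact hq.hasFPowerSeriesAt.eventually_eq_zero

theorem iteratedDeriv_comp_line (hΩ : IsOpen Ω) (hf : ContDiffOn ℝ ∞ f Ω) (x v : Plane) (n : ℕ)
    (hv : v = EuclideanSpace.single 0 1) : ContDiffOn ℝ ∞ ((pd 0)^[n] f) Ω ∧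
    ∀ t : ℝ, x + t • v ∈ Ω →
      iteratedDeriv n (fun t : ℝ => f (x + t • v)) t = (pd 0)^[n] f (x + t • v) := by
  induction n with
  | zero => simpa using hf
  | succ n ih =>
    refine ⟨by rw [Function.iterate_succ_apply']; exact smoothOn_pd hΩ ih.1, fun t ht => ?_⟩
    have hl (t : ℝ) : HasDerivAt (fun t : ℝ => x + t • v) v t := by
      simpa using ((hasDerivAt_id t).smul_const v).const_add x
    have hev : iteratedDeriv n (fun t : ℝ => f (x + t • v)) =ᶠ[𝓝 t]
        fun t => (pd 0)^[n] f (x + t • v) := by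
      filter_upwards [(hl t).continuousAt (hΩ.mem_nhds ht)] with s hs using ih.2 s hs
    rw [iteratedDeriv_succ, hev.deriv_eq, Function.iterate_succ_apply', pd, ← hv]
    exact ((differentiableAt_of_smoothOn hΩ ih.1 ht).hasFDerivAt.comp_hasDerivAt t (hl t)).deriv

/-- Uniqueness in the Cauchy problem for the Lamé system with data on the axis. -/
theorem PointwiseLame.eqOn_zero_of_cauchy_data (hb : Metric.ball p r ⊆ Ω) (hΩ : IsOpen Ω)
    (hp : p 0 = 0) (hz : SmoothField z Ω) (hE : PointwiseLame m k z Ω) (hm : m ≠ 0)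
    (hmk : m + k ≠ 0) (h0 : ∀ x ∈ Metric.ball p r, x 0 = 0 → z x = 0)
    (h1 : ∀ x ∈ Metric.ball p r, x 0 = 0 → Lame.pdField z x = 0) :
    EqOn z 0 (Metric.ball p r) := by
  -- The field ∂₁z satisfies the same hypotheses as z, so by induction all normal derivatives vanish
  -- on the axis.
  have hall (n : ℕ) : SmoothField (Lame.pdField^[n] z) Ω ∧
      PointwiseLame m k (Lame.pdField^[n] z) Ω ∧
      (∀ x ∈ Metric.ball p r, x 0 = 0 → Lame.pdField^[n] z x = 0) ∧
      ∀ x ∈ Metric.ball p r, x 0 = 0 → Lame.pdField (Lame.pdField^[n] z) x = 0 := by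
    induction n with
    | zero => exact ⟨hz, hE, h0, h1⟩
    | succ n ih =>
      rw [Function.iterate_succ_apply']
      exact ⟨ih.1.pdField hΩ, ih.2.1.pdField hΩ ih.1, ih.2.2.2,
        pdField_pdField_eq_zero_of_axis hb hΩ ih.1 ih.2.1 hm hmk ih.2.2.1 ih.2.2.2⟩
  have hiter (n : ℕ) (i : Fin 2) :
      (fun y => Lame.pdField^[n] z y i) = (pd 0)^[n] fun y => z y i := by
    induction n with
    | zero => rfl
    | succ n ih =>
      rw [Function.iterate_succ_apply', Function.iterate_succ_apply', ← ih]
      rfl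
  have hza := hE.analyticOnNhd hΩ hz hm hmk
  intro x hx
  let v : Plane := EuclideanSpace.single 0 1
  -- The foot of the perpendicular from x to the axis; it stays in the ball because the centre p
  -- lies on the axis.
  let x' : Plane := x - x 0 • v
  have hx'0 : x' 0 = 0 := by simp [x', v]
  have hx' : x' ∈ Metric.ball p r := by
    rw [Metric.mem_ball, EuclideanSpace.dist_eq] at hx ⊢
    refine lt_of_le_of_lt (Real.sqrt_le_sqrt ?_) hx
    simp [Fin.sum_univ_two, x', v, hp, Real.dist_eq]
    positivity
  -- The normal line meets the ball in an interval containing 0 and x₁, so the one-variable identity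
  -- theorem carries the vanishing from x' to x.
  let I : Set ℝ := (fun t : ℝ => x' + t • v) ⁻¹' Metric.ball p r
  have hI : Convex ℝ I := by
    have : (fun t : ℝ => x' + t • v) =
        (AffineMap.const ℝ ℝ x' + (LinearMap.toSpanSingleton ℝ Plane v).toAffineMap :
          ℝ →ᵃ[ℝ] Plane) := by
      ext t; simp
    simp only [I, this]
    exact (convex_ball p r).affine_preimage _
  have hline : AnalyticOnNhd ℝ (fun t : ℝ => x' + t • v) univ := fun t _ => by
    fun_prop
  have ha : AnalyticOnNhd ℝ (fun t : ℝ => z (x' + t • v)) I := fun t ht =>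
    (hza _ (hb ht)).comp_of_eq (hline t (mem_univ t)) rfl
  have h0I : (0 : ℝ) ∈ I := by simpa [I] using hx'
  have hev : (fun t : ℝ => z (x' + t • v)) =ᶠ[𝓝 0] 0 := by
    have hi (i) : (fun t : ℝ => z (x' + t • v) i) =ᶠ[𝓝 0] 0 := by
      refine eventuallyEq_zero_of_iteratedDeriv (analyticAt_pi_iff.1 (ha 0 h0I) i) fun n => ?_
      rw [(iteratedDeriv_comp_line hΩ (hz i) x' v n rfl).2 0 (hb h0I), ← hiter]
      have := (hall n).2.2.1 x' hx' hx'0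
      simpa using congrFun this i
    filter_upwards [hi 0, hi 1] with t ht0 ht1
    funext i
    fin_cases i
    · exact ht0
    · exact ht1
  have hxI : x 0 ∈ I := by simpa [I, x'] using hx
  have := ha.eqOn_zero_of_preconnected_of_eventuallyEq_zero hI.isPreconnected h0I hev hxI
  simpa [x'] using this

end CauchyUniqueness

/-! ### The reflected field and its agreement with D̃₀u near the axis. -/

section Reflection

variable {u : Field2} {f : Plane → ℂ} {Ω : Set Plane} {m k : ℂ} {x : Plane}

/-- The signs of the reflection on the coordinate directions. -/
def reflSign (j : Fin 2) : ℝ := if j = 0 then -1 else 1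

/-- The reflection as a continuous linear map. -/
def reflCLM : Plane →L[ℝ] Plane :=
  LinearMap.toContinuousLinearMap
    { toFun := refl
      map_add' := fun x y => by ext i; fin_cases i <;> simp [refl]; ring
      map_smul' := fun a x => by ext i; fin_cases i <;> simp [refl] }

theorem contDiff_refl : ContDiff ℝ ∞ refl := reflCLM.contDiff

theorem reflCLM_single (j : Fin 2) :
    reflCLM (EuclideanSpace.single j 1) = reflSign j • EuclideanSpace.single j 1 := by
  change refl _ = _
  ext i
  fin_cases i <;> fin_cases j <;> simp [refl, reflSign]

theorem pd_comp_refl (hΩ : IsOpen Ω) (hf : ContDiffOn ℝ ∞ f Ω) (hx : refl x ∈ Ω) (j : Fin 2) :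
    pd j (fun y => f (refl y)) x = (reflSign j : ℂ) * pd j f (refl x) := by
  have h : HasFDerivAt (fun y => f (refl y)) _ x :=
    (differentiableAt_of_smoothOn hΩ hf hx).hasFDerivAt.comp x (reflCLM.hasFDerivAt (x := x))
  rw [pd, h.fderiv, ContinuousLinearMap.comp_apply, reflCLM_single]
  simp [pd]

theorem pd_pd_comp_refl (hΩ : IsOpen Ω) (hs : ∀ x ∈ Ω, refl x ∈ Ω) (hf : ContDiffOn ℝ ∞ f Ω)
    (hx : x ∈ Ω) (i j : Fin 2) : pd i (pd j fun y => f (refl y)) x =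
      (reflSign i : ℂ) * (reflSign j : ℂ) * pd i (pd j f) (refl x) := by
  have hc : ContDiffOn ℝ ∞ (fun y => pd j f (refl y)) Ω :=
    (smoothOn_pd hΩ hf).comp contDiff_refl.contDiffOn hs
  rw [pd_eqOn hΩ (fun y hy => pd_comp_refl hΩ hf (hs y hy) j) hx, pd_const_mul hΩ hc hx,
    pd_comp_refl hΩ (smoothOn_pd hΩ hf) (hs x hx)]
  ring

theorem reflVal_apply (v : Fin 2 → ℂ) (i : Fin 2) : reflVal v i = (reflSign i : ℂ) * v i := by
  fin_cases i <;> simp [reflVal, reflSign]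

theorem smoothField_reflVal_refl (hs : ∀ x ∈ Ω, refl x ∈ Ω) (hu : SmoothField u Ω) :
    SmoothField (fun x => reflVal (u (refl x))) Ω := fun i => by
  simp only [reflVal_apply]
  exact contDiffOn_const.mul ((hu i).comp contDiff_refl.contDiffOn hs)

/-- The Lamé system is invariant under reflection. -/
theorem PointwiseLame.reflVal_refl (hΩ : IsOpen Ω) (hs : ∀ x ∈ Ω, refl x ∈ Ω)
    (hu : SmoothField u Ω) (hE : PointwiseLame m k u Ω) :
    PointwiseLame m k (fun x => reflVal (u (refl x))) Ω := by
  have hc (i) : ContDiffOn ℝ ∞ (fun y => u (refl y) i) Ω :=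
    (hu i).comp contDiff_refl.contDiffOn hs
  have hsq (i) : (reflSign i : ℂ) * reflSign i = 1 := by
    fin_cases i <;> simp [reflSign]
  have hd : EqOn (divergence fun x => reflVal (u (refl x)))
      (fun x => divergence u (refl x)) Ω := fun x hx => by
    simp only [divergence, reflVal_apply]
    rw [pd_const_mul hΩ (hc 0) hx, pd_const_mul hΩ (hc 1) hx,
      pd_comp_refl hΩ (hu 0) (hs x hx), pd_comp_refl hΩ (hu 1) (hs x hx)]
    linear_combination pd 0 (fun y => u y 0) (refl x) * hsq 0 +
      pd 1 (fun y => u y 1) (refl x) * hsq 1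
  intro i x hx
  rw [pd_eqOn hΩ hd hx, pd_comp_refl hΩ (smoothOn_divergence hΩ hu) (hs x hx)]
  simp only [reflVal_apply]
  rw [lapl_const_mul hΩ (hc i) hx, lapl, pd_pd_comp_refl hΩ hs (hu i) hx,
    pd_pd_comp_refl hΩ hs (hu i) hx, hsq, hsq]
  have := hE i (refl x) (hs x hx)
  rw [lapl] at this
  linear_combination (reflSign i : ℂ) * this

theorem refl_eq_self (hx : x 0 = 0) : refl x = x := by
  ext i
  fin_cases i <;> simp [refl, hx]

/-- Carries the results on `reflField` over to `dTilde`. Agreement is claimed only on Ω, where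
smoothness turns the Laplacian into iterated partial derivatives. -/
theorem dTilde_eqOn {lam mu : ℝ} (hΩ : IsOpen Ω) (hu : SmoothField u Ω) :
    EqOn (reflField (((lam + mu) / (lam + 3 * mu) : ℝ) : ℂ) u) (dTilde lam mu u) Ω := by
  intro x hx
  funext i
  have hl (i) : lap u x i = lapl (fun y => u y i) x :=
    laplacian_eq_lapl_of_smoothOn hΩ (hu i) hx
  fin_cases i
  · change reflFst _ u x = u x 0 + (((lam + mu) / (lam + 3 * mu) * x 0 ^ 2 : ℝ) : ℂ) * lap u x 0 +
      ((2 * ((lam + mu) / (lam + 3 * mu)) * x 0 : ℝ) : ℂ) * pd 1 (fun y => u y 1) x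
    rw [hl, reflFst, coord]
    push_cast
    ring
  · change reflSnd _ u x = -u x 1 + (((lam + mu) / (lam + 3 * mu) * x 0 ^ 2 : ℝ) : ℂ) * lap u x 1 +
      ((2 * ((lam + mu) / (lam + 3 * mu)) * x 0 : ℝ) : ℂ) * -pd 1 (fun y => u y 0) x
    rw [hl, reflSnd, coord]
    push_cast
    ring

theorem SmoothField.congr {v : Field2} (hu : SmoothField u Ω) (h : EqOn u v Ω) :
    SmoothField v Ω := fun i => (hu i).congr fun _ hx => (congrFun (h hx) i).symm

/-- The field `D̃₀ u` and the reflected field of a solution vanishing on the axis have the same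
Cauchy data there, so that they coincide nearby. -/
theorem reflField_eqOn_ball {p : Plane} {r : ℝ} (hΩ : IsOpen Ω)
    (hs : ∀ x ∈ Ω, refl x ∈ Ω) (hu : SmoothField u Ω) (hE : PointwiseLame m k u Ω)
    (hm : m ≠ 0) (hmk : m + k ≠ 0) {c : ℂ} (hc : c * (k + 2 * m) = k) (hp : p 0 = 0)
    (hb : Metric.ball p r ⊆ Ω) (hu0 : ∀ x ∈ Metric.ball p r, x 0 = 0 → u x = 0) :
    EqOn (reflField c u) (fun x => reflVal (u (refl x))) (Metric.ball p r) := by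
  have hw := smoothField_reflField hΩ hu c
  have hv := smoothField_reflVal_refl hs hu
  have hz : SmoothField (fun y i => reflField c u y i + (-1) * reflVal (u (refl y)) i) Ω :=
    fun i => (hw i).add (contDiffOn_const.mul (hv i))
  have hEz := PointwiseLame.add_const_mul hΩ hw hv (hE.reflField hΩ hu hm hmk hc)
    (hE.reflVal_refl hΩ hs hu) (-1)
  have key := hEz.eqOn_zero_of_cauchy_data hb hΩ hp hz hm hmk (fun x hx hx0 => ?_)
    fun x hx hx0 => ?_
  · intro x hx
    funext i
    have := congrFun (key hx) i
    simp only [Pi.zero_apply] at this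
    linear_combination this
  · have h0 := hu0 x hx hx0
    funext i
    rw [refl_eq_self hx0, reflVal_apply, h0]
    fin_cases i <;> simp [reflField, reflFst, reflSnd, coord, hx0, h0]
  -- Since ∂₂u = 0 on the axis, the terms with c drop out of ∂₁D̃₀u, leaving (∂₁u₁, -∂₁u₂);
  -- differentiating the reflected field gives the same.
  · have h1 (i) := pd_one_eq_zero_of_axis hb hΩ (hu i)
      (fun y hy hy0 => congrFun (hu0 y hy hy0) i) x hx hx0
    have hX : coord 0 x = 0 := by simp [coord, hx0]
    have hxr : refl x ∈ Ω := hs x (hb hx)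
    have hcr (i) : ContDiffOn ℝ ∞ (fun y => u (refl y) i) Ω :=
      (hu i).comp contDiff_refl.contDiffOn hs
    have hpd (i) := smoothOn_pd (j := 1) hΩ (hu i)
    have hl (i) := smoothOn_lapl hΩ (hu i)
    funext i
    simp only [pdField]
    rw [pd_add hΩ (hw i) (contDiffOn_const.mul (hv i)) (hb hx), pd_const_mul hΩ (hv i) (hb hx)]
    simp only [reflVal_apply]
    rw [pd_const_mul hΩ (hcr i) (hb hx), pd_comp_refl hΩ (hu i) hxr, refl_eq_self hx0]
    fin_cases i
    · have h2 : pd 0 (reflFst c u) x = _ := pd_quadratic hΩ (hu 0)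
        ((contDiffOn_const (c := 2 * c)).mul (hpd 1)) ((contDiffOn_const (c := c)).mul (hl 0)) 0
        (hb hx)
      change pd 0 (reflFst c u) x + _ = _
      rw [h2, hX, h1]
      simp [reflSign]
    · have h2 : pd 0 (reflSnd c u) x = _ := pd_quadratic hΩ
        ((contDiffOn_const (c := -1)).mul (hu 1)) ((contDiffOn_const (c := -2 * c)).mul (hpd 0))
        ((contDiffOn_const (c := c)).mul (hl 1)) 0 (hb hx)
      change pd 0 (reflSnd c u) x + _ = _
      rw [h2, hX, h1, pd_const_mul hΩ (hu 1) (hb hx)]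
      simp [reflSign]

end Reflection

end Lame

end

/-! ### The main theorem. -/

theorem theorem2p3 (lam mu : ℝ) (hmu : 0 < mu) (hlam : 0 < lam + 2 * mu)
    (Ω γ : Set Lame.Plane) (hΩo : IsOpen Ω) (hΩc : IsConnected Ω)
    (hΩs : ∀ x ∈ Ω, Lame.refl x ∈ Ω)
    (hγ : ∃ p ∈ Ω ∩ Lame.axisLine, γ = connectedComponentIn (Ω ∩ Lame.axisLine) p)
    (u : Lame.Field2) (hu : Lame.IsLameSolution lam mu Ω γ u) :
    AnalyticOnNhd ℝ u Ω ∧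
    Lame.IsLameSolution lam mu Ω γ (Lame.dTilde lam mu u) ∧
    (∀ x ∈ Ω, Lame.lameOp lam mu (Lame.dTilde lam mu u) x = 0) ∧
    (∀ x ∈ Ω, Lame.dTilde lam mu u x = Lame.reflVal (u (Lame.refl x))) := by
  open Lame in
  obtain ⟨p, hp, hγp⟩ := hγ
  have hm : (mu : ℂ) ≠ 0 := Complex.ofReal_ne_zero.2 hmu.ne'
  have hmk : (mu : ℂ) + ((lam + mu : ℝ) : ℂ) ≠ 0 := by
    rw [← Complex.ofReal_add]
    exact Complex.ofReal_ne_zero.2 (by linarith)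
  have hc : (((lam + mu) / (lam + 3 * mu) : ℝ) : ℂ) * (((lam + mu : ℝ) : ℂ) + 2 * (mu : ℂ)) =
      ((lam + mu : ℝ) : ℂ) := by
    have h : lam + 3 * mu ≠ 0 := by linarith
    have h' : (lam + mu) / (lam + 3 * mu) * ((lam + mu) + 2 * mu) = lam + mu := by
      rw [show lam + mu + 2 * mu = lam + 3 * mu by ring, div_mul_cancel₀ _ h]
    exact_mod_cast h'
  have hus := hu.smoothField hmu hlam hΩo
  have hE := pointwiseLame_of_weak hΩo hus hu.weak_eq
  have hwr := dTilde_eqOn (lam := lam) (mu := mu) hΩo hus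
  have hws := (smoothField_reflField hΩo hus _).congr hwr
  have hEr := hE.reflField hΩo hus hm hmk hc
  have hEw := hEr.congr hΩo hwr
  have hγΩ : γ ⊆ Ω ∩ axisLine := hγp ▸ connectedComponentIn_subset _ _
  refine ⟨hE.analyticOnNhd hΩo hus hm hmk, ⟨?_, ?_, ?_⟩, ?_, ?_⟩
  · exact continuousOn_pi.2 fun i => (hws i).continuousOn
  · exact fun φ hφ hφc hφΩ => hEw.weak hΩo hws hφ hφc hφΩ
  · intro x hx
    have hx0 : x 0 = 0 := (hγΩ hx).2
    have h0 := hu.eq_zero x hx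
    simp only [dTilde, h0, hx0]
    funext i
    fin_cases i <;> simp
  · intro x hx
    funext i
    rw [lameOp_eq hΩo hws hx, hEw i x hx]
    rfl
  · have hp0 : p 0 = 0 := hp.2
    obtain ⟨r, hr, hb⟩ := Metric.isOpen_iff.1 hΩo p hp.1
    -- A ball about p inside Ω meets the axis in a convex, hence connected, set containing p. That
    -- set lies in the component γ, so u vanishes on it.
    have hconv : Convex ℝ (Metric.ball p r ∩ axisLine) := by
      refine (convex_ball p r).inter fun x hx y hy a b _ _ _ => ?_
      have hx' : x 0 = 0 := hx
      have hy' : y 0 = 0 := hy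
      simp [axisLine, hx', hy']
    have hu0 : ∀ x ∈ Metric.ball p r, x 0 = 0 → u x = 0 := fun x hx hx0 => by
      refine hu.eq_zero x (hγp ▸ hconv.isPreconnected.subset_connectedComponentIn
        ⟨Metric.mem_ball_self hr, hp.2⟩ (Set.inter_subset_inter_left _ hb) ⟨hx, hx0⟩)
    have hball := reflField_eqOn_ball hΩo hΩs hus hE hm hmk hc hp0 hb hu0
    have ha := hEr.analyticOnNhd hΩo (smoothField_reflField hΩo hus _) hm hmk
    have hva := (hE.reflVal_refl hΩo hΩs hus).analyticOnNhd hΩo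
      (smoothField_reflVal_refl hΩs hus) hm hmk
    -- Both fields are analytic on the connected set Ω, so agreement near p spreads to all of Ω.
    have heq := ha.eqOn_of_preconnected_of_eventuallyEq hva hΩc.isPreconnected hp.1
      (hball.eventuallyEq_of_mem (Metric.ball_mem_nhds p hr))
    intro x hx
    rw [← hwr hx, heq hx]
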